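/- Let $\lambda_0,\mu,\delta,\alpha,\beta,L>0$. Let $T_1,T_2,\dots$ be the points of a homogeneous Poisson process of rate $\mu$ on $[0,\infty)$ (the shocks). Conditionally on the shocks, let $S_1,S_2,\dots$ be the points of a Poisson process on $[0,\infty)$ with intensity $$\lambda^*(s)=\lambda_0+\sum_{i:\,T_i\le s}e^{-\delta(s-T_i)},\qquad s\ge 0,$$ i.e. $(S_k)$ is a shot noise Cox process. Let $X^{(1)},X^{(2)},\dots$ be independent homogeneous gamma processes with parameters $\alpha,\beta$ and right-continuous paths, independent of $(T_i)$ and $(S_k)$: $X^{(k)}(0)=0$ a.s., the increments are independent, and $X^{(k)}(t)-X^{(k)}(s)$ has for $s<t$ the gamma distribution with shape $\alpha(t-s)$ and rate $\beta$. Let $\sigma_L^{(k)}=\inf\{t\ge0: X^{(k)}(t)>L\}$, let $W_k=S_k+\sigma_L^{(k)}$ be the time at which the $k$-th degradation process exceeds $L$, and let $W_{[1]}=\inf_k W_k$ be the system failure time. Then: 1. The times $\sigma_L^{(k)}$ have the common distribution function $F_{\sigma_L}$ given, on $[0,\infty)$, by $F_{\sigma_L}(0)=0$ and $F_{\sigma_L}(t)=\Gamma(\alpha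 t)^{-1}\int_{\beta L}^\infty z^{\alpha t-1}e^{-z}\,dz$ for $t>0$. 2. $W_{[1]}$ is an a.s. finite nonnegative random time with increasing failure rate (IFR): its survival function $\bar F(t)=P(W_{[1]}>t)$ is positive and differentiable on $[0,\infty)$ (from the right at $0$), and its failure rate (hazard) $r(t)=-\bar F'(t)/\bar F(t)$ is nondecreasing on $[0,\infty)$. No monotonicity of the failure rate of $\sigma_L^{(k)}$ is assumed. 3. For every $t\ge 0$, $$r(t)=\lambda_0F_{\sigma_L}(t)+\mu\left(1-\exp\left(-\int_0^te^{-\delta w}F_{\sigma_L}(t-w)\,dw\right)\right).$$ 4. $\lim_{t\to\infty}r(t)=\lambda_0+\mu\,(1-e^{-1/\delta})$. -/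

import Mathlib

open MeasureTheory ProbabilityTheory Set Filter Topology
open scoped ENNReal NNReal

namespace ShotNoise

variable {Ω : Type*} [MeasurableSpace Ω]

/-- The (possibly infinite) number of points of the sequence `S` that lie in `B`. -/
noncomputable def pointCount (S : ℕ → Ω → ℝ) (B : Set ℝ) (ω : Ω) : ℕ∞ :=
  {k : ℕ | S k ω ∈ B}.encard

/-- The random points `S 0, S 1, …` of the real line, listed in any order, form a Cox process
directed by the random measure `Λ`, which is a function of the information `𝓖`: conditionally on
`𝓖`, the numbers of points in disjoint bounded Borel sets are independent, and the number of
points in `B` has the Poisson distribution of mean `Λ B`. -/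
structure IsCoxProcess {Ω' : Type*} (𝓖 : MeasurableSpace Ω') [mΩ : MeasurableSpace Ω']
    (P : Measure Ω') (Λ : Ω' → Measure ℝ) (S : ℕ → Ω' → ℝ) : Prop where
  measurable : ∀ k, Measurable[mΩ] (S k)
  locallyFinite : ∀ᵐ ω ∂P, IsLocallyFiniteMeasure (Λ ω)
  condCount : ∀ (n : ℕ) (B : Fin n → Set ℝ), (∀ j, MeasurableSet (B j)) →
    (∀ j, Bornology.IsBounded (B j)) → Pairwise (fun i j => Disjoint (B i) (B j)) →
    ∀ c : Fin n → ℕ,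
      P⟦{ω | ∀ j, pointCount S (B j) ω = (c j : ℕ∞)} | 𝓖⟧ =ᵐ[P]
        fun ω => ∏ j, (poissonMeasure (Λ ω (B j)).toNNReal).real {c j}

/-- `T` lists the points of a Poisson process with the deterministic mean measure `ν`, that is, of
a Cox process whose directing measure is not random (conditioning on the trivial σ-algebra is no
conditioning). -/
def IsPoissonProcess (P : Measure Ω) (ν : Measure ℝ) (T : ℕ → Ω → ℝ) : Prop :=
  IsCoxProcess ⊥ P (fun _ => ν) T

/-- The shot noise intensity at time `s`: `lam + ∑_{i : T i ≤ s} exp (-δ (s - T i))`. -/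
noncomputable def intensity (lam δ : ℝ) (T : ℕ → Ω → ℝ) (ω : Ω) (s : ℝ) : ℝ≥0∞ :=
  ENNReal.ofReal lam +
    ∑' i, if T i ω ≤ s then ENNReal.ofReal (Real.exp (-δ * (s - T i ω))) else 0

/-- The random measure on `[0, ∞)` whose density is the shot noise intensity. -/
noncomputable def intensityMeasure (lam δ : ℝ) (T : ℕ → Ω → ℝ) (ω : Ω) : Measure ℝ :=
  (volume.restrict (Ici 0)).withDensity (intensity lam δ T ω)

/-- A homogeneous gamma process of parameters `α`, `β`, with right-continuous paths. The increment
over `[s, t]` has density `β ^ a / Γ(a) * x ^ (a - 1) * exp (-β x)` for `x > 0`,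
where `a = α (t - s)`. -/
structure IsGammaProcess (P : Measure Ω) (α β : ℝ) (X : ℝ≥0 → Ω → ℝ) : Prop where
  measurable : ∀ t, Measurable (X t)
  start : ∀ᵐ ω ∂P, X 0 ω = 0
  increment : ∀ s t : ℝ≥0, s < t →
    P.map (fun ω => X t ω - X s ω) = gammaMeasure (α * ((t : ℝ) - s)) β
  indep : HasIndepIncrements X P
  rightCont : ∀ᵐ ω ∂P, ∀ t, ContinuousWithinAt (fun s => X s ω) (Ici t) t

/-- The degradation model: the shock times `T` form a homogeneous Poisson process of rate `μ` on
`[0, ∞)`; the starting times `S` of the degradation processes form a shot noise Cox process, with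
base level `lam` and decay rate `δ`, driven by these shocks; the degradation processes `X 0, X 1, …`
are independent homogeneous gamma processes of parameters `α`, `β` (hence identically
distributed), independent of the shocks and of the starting times. -/
structure IsModel (P : Measure Ω) (lam μ δ α β : ℝ) (T S : ℕ → Ω → ℝ) (X : ℕ → ℝ≥0 → Ω → ℝ) :
    Prop where
  shocks : IsPoissonProcess P (ENNReal.ofReal μ • volume.restrict (Ici 0)) T
  starts : IsCoxProcess (MeasurableSpace.comap (fun ω i => T i ω) inferInstance) P
    (intensityMeasure lam δ T) S
  growth : ∀ k, IsGammaProcess P α β (X k)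
  growth_indep : iIndepFun (fun k ω t => X k t ω) P
  indep : IndepFun (fun ω => ((fun i => T i ω), (fun k => S k ω))) (fun ω k t => X k t ω) P

/-- The first time at which the path `X` exceeds the level `L` (`⊤` if there is none). -/
noncomputable def hittingTime (L : ℝ) (X : ℝ≥0 → Ω → ℝ) (ω : Ω) : EReal :=
  ⨅ (t : ℝ≥0) (_ : L < X t ω), ((t : ℝ) : EReal)

/-- The distribution function of the hitting time of `L`. -/
noncomputable def hittingCDF (P : Measure Ω) (L : ℝ) (X : ℝ≥0 → Ω → ℝ) (t : ℝ) : ℝ :=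
  P.real {ω | hittingTime L X ω ≤ (t : EReal)}

/-- The first time at which the level of one of the degradation processes exceeds `L`: the process
`k` does so at time `S k` plus its own hitting time. -/
noncomputable def failureTime (L : ℝ) (S : ℕ → Ω → ℝ) (X : ℕ → ℝ≥0 → Ω → ℝ) (ω : Ω) : EReal :=
  ⨅ k, ((S k ω : ℝ) : EReal) + hittingTime L (X k) ω

/-- The survival function of a random time. -/
noncomputable def survival (P : Measure Ω) (W : Ω → EReal) (t : ℝ) : ℝ :=
  P.real {ω | (t : EReal) < W ω}

/-- The failure rate (hazard) at time `t ≥ 0` of a random time: its density, which is minus the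
derivative of the survival function (the right derivative at `t = 0`), divided by the survival
function. -/
noncomputable def failureRate (P : Measure Ω) (W : Ω → EReal) (t : ℝ) : ℝ :=
  -derivWithin (survival P W) (Ici 0) t / survival P W t

/-- `W` is a finite nonnegative random time which has a failure rate as long as survival has
positive probability, and this failure rate is nondecreasing. -/
structure IsIFR (P : Measure Ω) (W : Ω → EReal) : Prop where
  aemeasurable : AEMeasurable W P
  nonneg_finite : ∀ᵐ ω ∂P, 0 ≤ W ω ∧ W ω < ⊤
  differentiable : ∀ t, 0 ≤ t → 0 < survival P W t →
    DifferentiableWithinAt ℝ (survival P W) (Ici 0) t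
  monotone : MonotoneOn (failureRate P W) {t | 0 ≤ t ∧ 0 < survival P W t}

end ShotNoise

/-! Fix `t ≥ 0`. Almost surely, the system survives past `t` exactly when every hitting time exceeds
`t - S k`. Given the starting times these events are independent, so the survival probability is the
mean of `∏ (1 - F (t - S k))`, with `F` the distribution function of the hitting time
(`IsModel.survival_eq_integral_finprod`).

The Laplace functional `E ∏ (1 - f (S k)) = E exp (-∫ f dΛ)` (`IsCoxProcess.integral_finprod`) is
then used twice. For the starting times it gives the mean of `exp (-∫ F (t - s) dΛ(s))`, where the
integral equals `lam * ∫₀ᵗ F` plus one term `G (t - T i)` per shock in `[0, t]`, with `G = expConv δ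
F`. The shocks thus enter through a product over the points of a Poisson process, and the second use
turns its mean into `exp (-μ ∫₀ᵗ (1 - exp (-G)))`.

Hence the survival function is `exp (-∫₀ᵗ r)` with `r = lam * F + μ * (1 - exp (-G))` continuous,
and `r` is the failure rate. It is nondecreasing because `F` and `G` are; only the monotonicity of a
distribution function enters. The limit follows from `F → 1` and `G → 1 / δ`.

The formula for `F` comes from the almost sure monotonicity of gamma paths, which ties the hitting
event to `L < X t`, and from continuity of the gamma tail in its shape. -/

namespace ShotNoise

/-! ### Gamma tails as functions of the shape. -/

/-- The regularized upper incomplete gamma function `Γ(a, c) / Γ(a)`. -/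
noncomputable def gammaTail (c a : ℝ) : ℝ :=
  (∫ z in Ioi c, z ^ (a - 1) * Real.exp (-z)) / Real.Gamma a

/-- `1 / Γ` is entire; at the poles the convention that `Γ` is `0` there agrees with the zeros of `1
/ Γ`. -/
lemma continuous_inv_Gamma : Continuous fun a : ℝ => (Real.Gamma a)⁻¹ := by
  have h : Continuous fun a : ℝ => ((Complex.Gamma (a : ℂ))⁻¹).re :=
    Complex.continuous_re.comp
      (Complex.differentiable_one_div_Gamma.continuous.comp Complex.continuous_ofReal)
  refine h.congr fun a => ?_
  rw [Complex.Gamma_ofReal, ← Complex.ofReal_inv, Complex.ofReal_re]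

lemma integrableOn_rpow_mul_exp_neg {c : ℝ} (hc : 0 < c) (a : ℝ) :
    IntegrableOn (fun z : ℝ => z ^ (a - 1) * Real.exp (-z)) (Ioi c) := by
  have h : IntegrableOn (fun z : ℝ => Real.exp (-z) * z ^ (max a 1 - 1)) (Ioi c) :=
    (Real.GammaIntegral_convergent (s := max a 1) (by positivity)).mono_set
      (Ioi_subset_Ioi hc.le)
  -- Raising the exponent to `max a 1` reaches the convergent Gamma integral; the leftover power of
  -- `z` is nonpositive, hence at most its value at `c`.
  have h2 := h.const_mul (c ^ (a - max a 1))
  refine Integrable.mono' h2 ?_ ?_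
  · exact (by fun_prop : Measurable fun z : ℝ => z ^ (a - 1) * Real.exp (-z)).aestronglyMeasurable
  · refine (ae_restrict_iff' measurableSet_Ioi).2 (ae_of_all _ fun z (hz : c < z) => ?_)
    have hz0 : 0 < z := hc.trans hz
    rw [Real.norm_of_nonneg (by positivity)]
    have : z ^ (a - 1) = z ^ (a - max a 1) * z ^ (max a 1 - 1) := by
      rw [← Real.rpow_add hz0]; ring_nf
    rw [this]
    have h3 : z ^ (a - max a 1) ≤ c ^ (a - max a 1) :=
      Real.rpow_le_rpow_of_nonpos hc hz.le (by simp)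
    calc z ^ (a - max a 1) * z ^ (max a 1 - 1) * Real.exp (-z)
        ≤ c ^ (a - max a 1) * z ^ (max a 1 - 1) * Real.exp (-z) := by gcongr
      _ = _ := by ring

/-- Dominated convergence: for `a` within `1` of `a₀`, the power of `z` is bounded by the one at `a₀
+ 1` when `z ≥ 1` and by the one at `a₀ - 1` when `z ≤ 1`. -/
lemma continuous_gammaTail {c : ℝ} (hc : 0 < c) : Continuous (gammaTail c) := by
  refine Continuous.mul ?_ continuous_inv_Gamma
  refine continuous_iff_continuousAt.2 fun a₀ => ?_
  refine continuousAt_of_dominated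
    (bound := fun z => z ^ ((a₀ - 1) - 1) * Real.exp (-z) + z ^ ((a₀ + 1) - 1) * Real.exp (-z))
    ?_ ?_ ((integrableOn_rpow_mul_exp_neg hc _).add (integrableOn_rpow_mul_exp_neg hc _)) ?_
  · exact .of_forall fun a =>
      (by fun_prop : Measurable fun z : ℝ => z ^ (a - 1) * Real.exp (-z)).aestronglyMeasurable
  · filter_upwards [Icc_mem_nhds (show a₀ - 1 < a₀ by linarith) (show a₀ < a₀ + 1 by linarith)]
      with a ha
    refine (ae_restrict_iff' measurableSet_Ioi).2 (ae_of_all _ fun z (hz : c < z) => ?_)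
    have hz0 : 0 < z := hc.trans hz
    rw [Real.norm_of_nonneg (by positivity), ← add_mul]
    gcongr
    rcases le_total 1 z with h1 | h1
    · have : z ^ (a - 1) ≤ z ^ ((a₀ + 1) - 1) :=
        Real.rpow_le_rpow_of_exponent_le h1 (by linarith [ha.2])
      have : 0 ≤ z ^ ((a₀ - 1) - 1) := by positivity
      linarith
    · have : z ^ (a - 1) ≤ z ^ ((a₀ - 1) - 1) :=
        Real.rpow_le_rpow_of_exponent_ge hz0 h1 (by linarith [ha.1])
      have : 0 ≤ z ^ ((a₀ + 1) - 1) := by positivity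
      linarith
  · refine (ae_restrict_iff' measurableSet_Ioi).2 (ae_of_all _ fun z (hz : c < z) => ?_)
    have hz0 : z ≠ 0 := (hc.trans hz).ne'
    have : Continuous fun a : ℝ => z ^ (a - 1) := by
      exact (Real.continuous_const_rpow hz0).comp (by fun_prop)
    exact (this.mul continuous_const).continuousAt

/-- The division by `Real.Gamma 0 = 0` gives the true limit at shape `0`, so one formula covers time
`0` as well. -/
lemma gammaTail_zero (c : ℝ) : gammaTail c 0 = 0 := by simp [gammaTail]

/-- At an integer shape the missing part `∫₀ᶜ zⁿ e⁻ᶻ dz` is at most `c ^ (n + 1)`, negligible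
against `n!`; this is what makes `F` tend to `1`. -/
lemma gammaTail_natCast_add_one_ge {c : ℝ} (hc : 0 < c) (n : ℕ) :
    1 - c * (c ^ n / n.factorial) ≤ gammaTail c (n + 1) := by
  have hG : Real.Gamma (n + 1) = n.factorial := Real.Gamma_nat_eq_factorial n
  have hint : IntegrableOn (fun z : ℝ => z ^ ((n + 1 : ℝ) - 1) * Real.exp (-z)) (Ioi 0) := by
    simpa only [mul_comm] using Real.GammaIntegral_convergent (s := (n : ℝ) + 1) (by positivity)
  have hsplit : Real.Gamma (n + 1) = (∫ z in Ioc 0 c, z ^ ((n + 1 : ℝ) - 1) * Real.exp (-z)) +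
      ∫ z in Ioi c, z ^ ((n + 1 : ℝ) - 1) * Real.exp (-z) := by
    rw [← setIntegral_union (by simp) measurableSet_Ioi
      (hint.mono_set Ioc_subset_Ioi_self) (hint.mono_set (Ioi_subset_Ioi hc.le)),
      Ioc_union_Ioi_eq_Ioi hc.le, Real.Gamma_eq_integral (by positivity)]
    simp only [mul_comm]
  have hle : (∫ z in Ioc 0 c, z ^ ((n + 1 : ℝ) - 1) * Real.exp (-z)) ≤ c ^ n * c := by
    have := norm_setIntegral_le_of_norm_le_const (μ := volume) (s := Ioc 0 c)
      (f := fun z : ℝ => z ^ ((n + 1 : ℝ) - 1) * Real.exp (-z)) (C := c ^ n) (by simp)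
      (fun z hz => ?_)
    · refine (le_abs_self _).trans (this.trans_eq ?_)
      simp [Measure.real, hc.le]
    · have := hz.1
      rw [Real.norm_of_nonneg (by positivity), add_sub_cancel_right, Real.rpow_natCast]
      calc z ^ n * Real.exp (-z) ≤ c ^ n * 1 := by
            gcongr
            · exact hz.2
            · simpa using this.le
        _ = c ^ n := mul_one _
  have hf : (0 : ℝ) < n.factorial := by positivity
  rw [gammaTail, hG, le_div_iff₀ hf]
  have : (1 - c * (c ^ n / n.factorial)) * n.factorial = n.factorial - c ^ n * c := by
    field_simp
  linarith

lemma gammaMeasure_Ioi {a β L : ℝ} (ha : 0 < a) (hβ : 0 < β) (hL : 0 < L) :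
    (gammaMeasure a β).real (Ioi L) = gammaTail (β * L) a := by
  rw [measureReal_def, gammaMeasure, withDensity_apply _ measurableSet_Ioi]
  have h1 : ∫ x in Ioi L, gammaPDFReal a β x =
      (∫⁻ x in Ioi L, gammaPDF a β x).toReal :=
    integral_eq_lintegral_of_nonneg_ae (ae_of_all _ fun b => gammaPDFReal_nonneg ha hβ b)
      (by fun_prop)
  rw [← h1]
  have h2 := integral_comp_mul_left_Ioi (fun z : ℝ => z ^ (a - 1) * Real.exp (-z)) L hβ
  have h3 : ∀ x ∈ Ioi L, gammaPDFReal a β x =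
      β / Real.Gamma a * ((β * x) ^ (a - 1) * Real.exp (-(β * x))) := by
    intro x hx
    have hx0 : 0 < x := hL.trans hx
    rw [gammaPDFReal, if_pos hx0.le, Real.mul_rpow hβ.le hx0.le,
      show β ^ a = β * β ^ (a - 1) by
        rw [Real.rpow_sub_one hβ.ne']; field_simp]
    ring
  rw [setIntegral_congr_fun measurableSet_Ioi h3, integral_const_mul, h2, gammaTail, smul_eq_mul]
  field_simp

/-! ### The law of the hitting time. -/

section Hitting

variable {Ω : Type*}

lemma hittingTime_nonneg (L : ℝ) (X : ℝ≥0 → Ω → ℝ) (ω : Ω) : 0 ≤ hittingTime L X ω :=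
  le_iInf₂ fun t _ => by exact_mod_cast t.2

lemma hittingTime_lt_iff {L : ℝ} {X : ℝ≥0 → Ω → ℝ} {ω : Ω} {t : ℝ} :
    hittingTime L X ω < (t : EReal) ↔ ∃ s : ℝ≥0, L < X s ω ∧ (s : ℝ) < t := by
  simp only [hittingTime, iInf_lt_iff, EReal.coe_lt_coe_iff, exists_prop]

/-- The infimum of the times in a countable dense set at which the path `x` exceeds the level. -/
noncomputable def denseHittingTime (L : ℝ) (x : ℝ≥0 → ℝ) : EReal :=
  ⨅ n : ℕ, if L < x (TopologicalSpace.denseSeq ℝ≥0 n) then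
    (((TopologicalSpace.denseSeq ℝ≥0 n : ℝ≥0) : ℝ) : EReal) else ⊤

/-- A countable infimum is measurable for the product σ-algebra on all paths, so independence of the
paths passes to the hitting times. -/
lemma measurable_denseHittingTime (L : ℝ) : Measurable (denseHittingTime L) :=
  Measurable.iInf fun _ => Measurable.ite
    (measurableSet_lt measurable_const (measurable_pi_apply _)) measurable_const measurable_const

lemma exists_denseSeq_of_lt {L : ℝ} {x : ℝ≥0 → ℝ} (hx : ∀ t, ContinuousWithinAt x (Ici t) t)
    {s : ℝ≥0} {t : ℝ} (hs : L < x s) (hst : (s : ℝ) < t) :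
    ∃ n, L < x (TopologicalSpace.denseSeq ℝ≥0 n) ∧
      ((TopologicalSpace.denseSeq ℝ≥0 n : ℝ≥0) : ℝ) < t := by
  have h1 : ∀ᶠ u in 𝓝[>] s, L < x u :=
    ((hx s).mono_left (nhdsWithin_mono _ Ioi_subset_Ici_self)).eventually (lt_mem_nhds hs)
  have h2 : ∀ᶠ u : ℝ≥0 in 𝓝[>] s, (u : ℝ) < t :=
    (NNReal.continuous_coe.continuousWithinAt.tendsto).eventually (gt_mem_nhds hst)
  obtain ⟨b, hb, hsub⟩ := (mem_nhdsGT_iff_exists_Ioo_subset).1 (h1.and h2)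
  obtain ⟨n, hn⟩ := (TopologicalSpace.denseRange_denseSeq ℝ≥0).exists_mem_open
    (isOpen_Ioo (a := s) (b := b)) (nonempty_Ioo.2 hb)
  exact ⟨n, hsub hn⟩

lemma denseHittingTime_eq {L : ℝ} {X : ℝ≥0 → Ω → ℝ} {ω : Ω}
    (hx : ∀ t, ContinuousWithinAt (fun s => X s ω) (Ici t) t) :
    denseHittingTime L (fun t => X t ω) = hittingTime L X ω := by
  apply le_antisymm
  · refine EReal.le_of_forall_lt_iff_le.1 fun z hz => ?_
    obtain ⟨s, hs, hsz⟩ := hittingTime_lt_iff.1 hz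
    obtain ⟨n, hn, hnz⟩ := exists_denseSeq_of_lt hx hs hsz
    refine (iInf_le _ n).trans ?_
    rw [if_pos hn]
    exact_mod_cast hnz.le
  · refine le_iInf fun n => ?_
    split_ifs with h
    · exact iInf₂_le (f := fun (t : ℝ≥0) (_ : L < X t ω) => ((t : ℝ) : EReal)) _ h
    · exact le_top

variable [MeasurableSpace Ω] {P : Measure Ω} {α β L : ℝ} {X : ℝ≥0 → Ω → ℝ}

lemma IsGammaProcess.ae_denseHittingTime_eq (h : IsGammaProcess P α β X) :
    ∀ᵐ ω ∂P, denseHittingTime L (fun t => X t ω) = hittingTime L X ω :=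
  h.rightCont.mono fun _ hω => denseHittingTime_eq hω

lemma IsGammaProcess.ae_le (h : IsGammaProcess P α β X) {s t : ℝ≥0} (hst : s ≤ t) :
    ∀ᵐ ω ∂P, X s ω ≤ X t ω := by
  rcases hst.eq_or_lt with rfl | hst
  · exact ae_of_all _ fun _ => le_rfl
  have h0 : P.map (fun ω => X t ω - X s ω) (Iio 0) = 0 := by
    rw [h.increment s t hst, gammaMeasure, withDensity_apply _ measurableSet_Iio]
    exact lintegral_gammaPDF_of_nonpos le_rfl
  have hm : Measurable fun ω => X t ω - X s ω := (h.measurable t).sub (h.measurable s)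
  rw [Measure.map_apply hm measurableSet_Iio] at h0
  have : ∀ᵐ ω ∂P, ω ∉ (fun ω => X t ω - X s ω) ⁻¹' Iio 0 := measure_eq_zero_iff_ae_notMem.1 h0
  filter_upwards [this] with ω hω
  simpa using hω

lemma IsGammaProcess.real_lt (h : IsGammaProcess P α β X) (hα : 0 < α) (hβ : 0 < β) (hL : 0 < L)
    {t : ℝ≥0} (ht : 0 < t) : P.real {ω | L < X t ω} = gammaTail (β * L) (α * t) := by
  have h1 := h.increment 0 t ht
  have hm : Measurable fun ω => X t ω - X 0 ω := (h.measurable t).sub (h.measurable 0)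
  rw [NNReal.coe_zero, sub_zero] at h1
  rw [← gammaMeasure_Ioi (mul_pos hα (by exact_mod_cast ht)) hβ hL, ← h1,
    map_measureReal_apply hm measurableSet_Ioi]
  refine measureReal_congr ?_
  filter_upwards [h.start] with ω hω
  apply propext
  change L < X t ω ↔ L < X t ω - X 0 ω
  rw [hω, sub_zero]

/-- Monotonicity holds almost surely for each pair of times, with a null set depending on the pair.
Right-continuity moves the exceedance to one of countably many times, where the null sets can be
united. -/
lemma IsGammaProcess.ae_lt_of_hittingTime_lt (h : IsGammaProcess P α β X) (t : ℝ≥0) :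
    ∀ᵐ ω ∂P, hittingTime L X ω < ((t : ℝ) : EReal) → L < X t ω := by
  have h1 : ∀ᵐ ω ∂P, ∀ n, TopologicalSpace.denseSeq ℝ≥0 n < t →
      X (TopologicalSpace.denseSeq ℝ≥0 n) ω ≤ X t ω :=
    ae_all_iff.2 fun n => by
      by_cases hn : TopologicalSpace.denseSeq ℝ≥0 n < t
      · filter_upwards [h.ae_le hn.le] with ω hω _ using hω
      · exact ae_of_all _ fun _ h' => absurd h' hn
  filter_upwards [h1, h.rightCont] with ω hω hr hlt
  obtain ⟨s, hs, hst⟩ := hittingTime_lt_iff.1 hlt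
  obtain ⟨n, hn, hnt⟩ := exists_denseSeq_of_lt hr hs hst
  exact hn.trans_le (hω n (by exact_mod_cast hnt))

/-- Up to null sets, `{σ ≤ t}` contains `{L < X t}` and lies in `{L < X u}` for every `u > t`;
continuity in the shape closes the gap as `u ↓ t`. -/
lemma IsGammaProcess.hittingCDF_of_nonneg [IsProbabilityMeasure P] (h : IsGammaProcess P α β X) (hα : 0 < α) (hβ : 0 < β)
    (hL : 0 < L) {t : ℝ} (ht : 0 ≤ t) :
    hittingCDF P L X t = gammaTail (β * L) (α * t) := by
  apply le_antisymm
  · have hlim : Tendsto (fun u => gammaTail (β * L) (α * u)) (𝓝[>] t)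
        (𝓝 (gammaTail (β * L) (α * t))) :=
      (((continuous_gammaTail (mul_pos hβ hL)).comp (by fun_prop : Continuous fun u => α * u)).tendsto
        t).mono_left nhdsWithin_le_nhds
    refine ge_of_tendsto hlim ?_
    filter_upwards [self_mem_nhdsWithin] with u (hu : t < u)
    lift u to ℝ≥0 using ht.trans hu.le
    have hu0 : 0 < u := by exact_mod_cast ht.trans_lt hu
    rw [← h.real_lt hα hβ hL hu0]
    refine ENNReal.toReal_mono (measure_ne_top _ _) (measure_mono_ae ?_)
    filter_upwards [h.ae_lt_of_hittingTime_lt u] with ω hω hle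
    exact hω (lt_of_le_of_lt hle (by exact_mod_cast hu))
  · rcases ht.eq_or_lt with rfl | ht0
    · rw [mul_zero, gammaTail_zero]
      exact measureReal_nonneg
    · lift t to ℝ≥0 using ht
      rw [← h.real_lt hα hβ hL (by exact_mod_cast ht0)]
      exact measureReal_mono fun ω hω =>
        show hittingTime L X ω ≤ ((t : ℝ) : EReal) from iInf₂_le t hω

lemma hittingCDF_of_neg {t : ℝ} (ht : t < 0) : hittingCDF P L X t = 0 := by
  have : {ω | hittingTime L X ω ≤ (t : EReal)} = ∅ := by
    ext ω
    simp only [mem_ofPred_eq, mem_empty_iff_false, iff_false, not_le]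
    exact lt_of_lt_of_le (by exact_mod_cast ht) (hittingTime_nonneg L X ω)
  rw [hittingCDF, this, measureReal_empty]

lemma IsGammaProcess.hittingCDF_eq [IsProbabilityMeasure P] (h : IsGammaProcess P α β X) (hα : 0 < α) (hβ : 0 < β)
    (hL : 0 < L) (t : ℝ) : hittingCDF P L X t = gammaTail (β * L) (α * max t 0) := by
  rcases le_or_gt 0 t with ht | ht
  · rw [h.hittingCDF_of_nonneg hα hβ hL ht, max_eq_left ht]
  · rw [hittingCDF_of_neg ht, max_eq_right ht.le, mul_zero, gammaTail_zero]

lemma monotone_hittingCDF [IsProbabilityMeasure P] : Monotone (hittingCDF P L X) :=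
  fun s t hst => measureReal_mono fun ω (hω : hittingTime L X ω ≤ (s : EReal)) =>
    show hittingTime L X ω ≤ (t : EReal) from hω.trans (by exact_mod_cast hst)

lemma hittingCDF_nonneg (t : ℝ) : 0 ≤ hittingCDF P L X t := measureReal_nonneg

lemma hittingCDF_le_one [IsProbabilityMeasure P] (t : ℝ) : hittingCDF P L X t ≤ 1 := measureReal_le_one

lemma IsGammaProcess.continuous_hittingCDF [IsProbabilityMeasure P] (h : IsGammaProcess P α β X) (hα : 0 < α) (hβ : 0 < β)
    (hL : 0 < L) : Continuous (hittingCDF P L X) := by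
  rw [funext (h.hittingCDF_eq hα hβ hL)]
  exact (continuous_gammaTail (mul_pos hβ hL)).comp (by fun_prop)

lemma IsGammaProcess.tendsto_hittingCDF [IsProbabilityMeasure P] (h : IsGammaProcess P α β X) (hα : 0 < α) (hβ : 0 < β)
    (hL : 0 < L) : Tendsto (hittingCDF P L X) atTop (𝓝 1) := by
  have hc := mul_pos hβ hL
  -- At time `(n + 1) / α` the shape is the integer `n + 1`; for a monotone function the limit along
  -- these times suffices.
  have hu : Tendsto (fun n : ℕ => ((n : ℝ) + 1) / α) atTop atTop :=
    (tendsto_atTop_add_const_right _ _ tendsto_natCast_atTop_atTop).atTop_div_const hα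
  refine (tendsto_iff_tendsto_subseq_of_monotone monotone_hittingCDF hu).2 ?_
  have hlim : Tendsto (fun n : ℕ => 1 - β * L * ((β * L) ^ n / n.factorial)) atTop (𝓝 1) := by
    simpa using ((FloorSemiring.tendsto_pow_div_factorial_atTop (β * L)).const_mul
      (β * L)).const_sub 1
  refine tendsto_of_tendsto_of_tendsto_of_le_of_le hlim tendsto_const_nhds (fun n => ?_)
    fun n => hittingCDF_le_one _
  have := gammaTail_natCast_add_one_ge hc n
  simp only [Function.comp]
  rw [h.hittingCDF_of_nonneg hα hβ hL (by positivity), mul_div_cancel₀ _ hα.ne']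
  exact this

end Hitting

/-! ### Poisson counts and the Laplace functional of step functions. -/

lemma tsum_prod_fin (n : ℕ) (h : Fin n → ℕ → ℝ≥0∞) :
    ∑' c : Fin n → ℕ, ∏ j, h j (c j) = ∏ j, ∑' c, h j c := by
  induction n with
  | zero => simp [tsum_fintype]
  | succ n ih =>
    rw [← (Fin.consEquiv fun _ : Fin (n + 1) => ℕ).tsum_eq, ENNReal.tsum_prod', Fin.prod_univ_succ,
      ← ih, ← ENNReal.tsum_mul_right]
    simp [Fin.consEquiv, Fin.prod_univ_succ, ENNReal.tsum_mul_left]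

/-- The Poisson generating function; `p = 1` also serves, as total mass one, to show that counts are
finite. -/
lemma tsum_pow_mul_poissonMeasure (r : ℝ≥0) {p : ℝ} (hp : 0 ≤ p) :
    ∑' c : ℕ, ENNReal.ofReal (p ^ c * (poissonMeasure r).real {c}) =
      ENNReal.ofReal (Real.exp (-((1 - p) * r))) := by
  have h : HasSum (fun c : ℕ => p ^ c * (poissonMeasure r).real {c})
      (Real.exp (-((1 - p) * r))) := by
    have := (NormedSpace.expSeries_div_hasSum_exp (p * r : ℝ)).mul_left (Real.exp (-r))
    rw [← Real.exp_eq_exp_ℝ, ← Real.exp_add] at this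
    have he : -((1 - p) * (r : ℝ)) = -r + p * r := by ring
    rw [he]
    refine this.congr_fun fun c => ?_
    rw [poissonMeasure_real_singleton, mul_pow]
    ring
  rw [← h.tsum_eq, ENNReal.ofReal_tsum_of_nonneg (fun c => by positivity) h.summable]

section Count

variable {Ω : Type*} {𝓖 : MeasurableSpace Ω} [mΩ : MeasurableSpace Ω] {P : Measure Ω}
  {Λ : Ω → Measure ℝ} {S : ℕ → Ω → ℝ}

lemma IsCoxProcess.measurableSet_pointCount_eq (h : IsCoxProcess 𝓖 P Λ S) {B : Set ℝ}
    (hB : MeasurableSet B) (c : ℕ) : MeasurableSet {ω | pointCount S B ω = (c : ℕ∞)} := by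
  -- The indices of the points in `B` form one of countably many finite sets.
  have : {ω | pointCount S B ω = (c : ℕ∞)} =
      ⋃ F : {F : Finset ℕ // F.card = c}, ⋂ k : ℕ, {ω | S k ω ∈ B ↔ k ∈ F.1} := by
    ext ω
    simp only [mem_ofPred_eq, mem_iUnion, mem_iInter]
    constructor
    · intro hc
      have hfin : {k : ℕ | S k ω ∈ B}.Finite := finite_of_encard_eq_coe hc
      refine ⟨⟨hfin.toFinset, ?_⟩, fun k => by simp⟩
      rw [pointCount, hfin.encard_eq_coe_toFinset_card] at hc
      exact_mod_cast hc
    · rintro ⟨⟨F, hF⟩, hk⟩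
      have : {k : ℕ | S k ω ∈ B} = (F : Set ℕ) := by
        ext k
        simpa using hk k
      rw [pointCount, this, encard_coe_eq_coe_finsetCard, hF]
  rw [this]
  refine MeasurableSet.iUnion fun F => MeasurableSet.iInter fun k => ?_
  by_cases hk : k ∈ F.1
  · simp only [hk, iff_true]
    exact h.measurable k hB
  · simp only [hk, iff_false]
    exact (h.measurable k hB).compl

variable [IsProbabilityMeasure P]

/-- No measurability of `Λ` is part of the definition: that of the Poisson weights is inherited from
the conditional expectation they agree with almost everywhere. -/
lemma IsCoxProcess.measure_pointCount (h : IsCoxProcess 𝓖 P Λ S) (h𝓖 : 𝓖 ≤ mΩ) {n : ℕ}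
    {B : Fin n → Set ℝ} (hB : ∀ j, MeasurableSet (B j)) (hb : ∀ j, Bornology.IsBounded (B j))
    (hd : Pairwise fun i j => Disjoint (B i) (B j)) (c : Fin n → ℕ) :
    MeasurableSet {ω | ∀ j, pointCount S (B j) ω = (c j : ℕ∞)} ∧
    AEMeasurable (fun ω => ∏ j, (poissonMeasure (Λ ω (B j)).toNNReal).real {c j}) P ∧
    P {ω | ∀ j, pointCount S (B j) ω = (c j : ℕ∞)} =
      ∫⁻ ω, ENNReal.ofReal (∏ j, (poissonMeasure (Λ ω (B j)).toNNReal).real {c j}) ∂P := by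
  have hA : MeasurableSet {ω | ∀ j, pointCount S (B j) ω = (c j : ℕ∞)} := by
    have : {ω | ∀ j, pointCount S (B j) ω = (c j : ℕ∞)} =
        ⋂ j, {ω | pointCount S (B j) ω = (c j : ℕ∞)} := by ext; simp
    rw [this]
    exact MeasurableSet.iInter fun j => h.measurableSet_pointCount_eq (hB j) (c j)
  have hc := h.condCount n B hB hb hd c
  have hint := integrable_condExp.congr hc
  refine ⟨hA, hint.aestronglyMeasurable.aemeasurable, ?_⟩
  rw [← ofReal_integral_eq_lintegral_ofReal hint (ae_of_all _ fun ω =>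
    Finset.prod_nonneg fun j _ => measureReal_nonneg), ← integral_congr_ae hc,
    integral_condExp h𝓖]
  refine (ofReal_measureReal (μ := P)).symm.trans (congrArg _ ?_)
  exact (integral_indicator_one hA).symm

/-- The Poisson weights of the finite counts sum to one, which leaves no mass for an infinite count;
balls of integer radius handle all bounded sets at once. -/
lemma IsCoxProcess.ae_finite (h : IsCoxProcess 𝓖 P Λ S) (h𝓖 : 𝓖 ≤ mΩ) :
    ∀ᵐ ω ∂P, ∀ B : Set ℝ, Bornology.IsBounded B → {k | S k ω ∈ B}.Finite := by
  have key : ∀ m : ℕ, ∀ᵐ ω ∂P, {k | S k ω ∈ Metric.closedBall (0 : ℝ) m}.Finite := by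
    intro m
    have hm := h.measure_pointCount h𝓖 (n := 1) (B := fun _ => Metric.closedBall (0 : ℝ) m)
      (fun _ => measurableSet_closedBall) (fun _ => Metric.isBounded_closedBall)
      (fun i j hij => absurd (Subsingleton.elim i j) hij)
    set A : ℕ → Set Ω := fun c => {ω | pointCount S (Metric.closedBall (0 : ℝ) m) ω = (c : ℕ∞)}
    have hA : ∀ c, MeasurableSet (A c) :=
      fun c => h.measurableSet_pointCount_eq measurableSet_closedBall c
    have hU : P (⋃ c, A c) = 1 := by
      rw [measure_iUnion _ hA]
      · have h1 : ∀ c, P (A c) = ∫⁻ ω, ENNReal.ofReal ((1 : ℝ) ^ c *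
            (poissonMeasure (Λ ω (Metric.closedBall (0 : ℝ) m)).toNNReal).real {c}) ∂P := by
          intro c
          simpa using (hm fun _ => c).2.2
        simp_rw [h1]
        rw [← lintegral_tsum]
        · simp_rw [tsum_pow_mul_poissonMeasure _ zero_le_one]
          simp
        · intro c
          have := (hm fun _ => c).2.1
          simp only [Finset.univ_unique, Finset.prod_const, Finset.card_singleton, pow_one] at this
          simpa using this.ennreal_ofReal
      · intro c c' hcc
        refine Set.disjoint_left.2 fun ω (hω : _ = _) (hω' : _ = _) => hcc ?_
        exact_mod_cast hω.symm.trans hω'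
    have := (prob_compl_eq_zero_iff (MeasurableSet.iUnion hA)).2 hU
    filter_upwards [measure_eq_zero_iff_ae_notMem.1 this] with ω hω
    simp only [mem_compl_iff, not_not, mem_iUnion] at hω
    obtain ⟨c, hc⟩ := hω
    exact finite_of_encard_eq_coe (k := c) hc
  filter_upwards [ae_all_iff.2 key] with ω hω B hB
  obtain ⟨r, hr⟩ := hB.subset_closedBall 0
  obtain ⟨m, hm⟩ := exists_nat_ge r
  exact (hω m).subset fun k hk => Metric.closedBall_subset_closedBall hm (hr hk)

/-- Finiteness matters: `∏ᶠ` is `1` by default when infinitely many factors differ from `1`. -/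
lemma finprod_ite_eq_prod_pow {n : ℕ} {B : Fin n → Set ℝ} (p : Fin n → ℝ) {x : ℕ → ℝ}
    [∀ j, DecidablePred (· ∈ B j)] (hf : ∀ j, {k | x k ∈ B j}.Finite) :
    ∏ᶠ k, ∏ j, (if x k ∈ B j then p j else 1) = ∏ j, p j ^ {k | x k ∈ B j}.ncard := by
  have hfin : (⋃ j, {k | x k ∈ B j}).Finite := finite_iUnion hf
  rw [finprod_eq_prod_of_mulSupport_subset (s := hfin.toFinset), Finset.prod_comm]
  · refine Finset.prod_congr rfl fun j _ => ?_
    rw [Finset.prod_ite, Finset.prod_const_one, mul_one, Finset.prod_const]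
    congr 1
    rw [← Set.ncard_coe_finset]
    congr 1
    ext k
    simp only [Finset.coe_filter, Finite.mem_toFinset, mem_iUnion, mem_ofPred_eq]
    exact ⟨fun hk => hk.2, fun hk => ⟨⟨j, hk⟩, hk⟩⟩
  · intro k hk
    simp only [Finite.coe_toFinset, mem_iUnion, mem_ofPred_eq]
    by_contra! hcon
    exact hk (Finset.prod_eq_one fun j _ => if_neg (hcon j))

-- Both sides are expanded over the vectors `c` of counts: the product is `∏ p j ^ c j` on the event
-- with counts `c`, and summing against the Poisson weights gives a product of generating functions.
open Classical in
lemma IsCoxProcess.lintegral_finprod_step (h : IsCoxProcess 𝓖 P Λ S) (h𝓖 : 𝓖 ≤ mΩ) {n : ℕ}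
    {B : Fin n → Set ℝ} (hB : ∀ j, MeasurableSet (B j)) (hb : ∀ j, Bornology.IsBounded (B j))
    (hd : Pairwise fun i j => Disjoint (B i) (B j)) {p : Fin n → ℝ} (hp : ∀ j, 0 ≤ p j) :
    AEMeasurable (fun ω => ∏ᶠ k, ∏ j, (if S k ω ∈ B j then p j else 1)) P ∧
    AEMeasurable (fun ω => ∏ j, Real.exp (-((1 - p j) * (Λ ω).real (B j)))) P ∧
    ∫⁻ ω, ENNReal.ofReal (∏ᶠ k, ∏ j, (if S k ω ∈ B j then p j else 1)) ∂P =
      ∫⁻ ω, ENNReal.ofReal (∏ j, Real.exp (-((1 - p j) * (Λ ω).real (B j)))) ∂P := by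
  have hm := h.measure_pointCount h𝓖 hB hb hd
  set A : (Fin n → ℕ) → Set Ω := fun c => {ω | ∀ j, pointCount S (B j) ω = (c j : ℕ∞)} with hAdef
  have hleft : (fun ω => ENNReal.ofReal (∏ᶠ k, ∏ j, (if S k ω ∈ B j then p j else 1))) =ᵐ[P]
      fun ω => ∑' c : Fin n → ℕ, (A c).indicator
        (fun _ => ∏ j, ENNReal.ofReal (p j ^ c j)) ω := by
    filter_upwards [h.ae_finite h𝓖] with ω hω
    have hfin := fun j => hω (B j) (hb j)
    rw [finprod_ite_eq_prod_pow p hfin,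
      tsum_eq_single fun j => {k | S k ω ∈ B j}.ncard]
    · rw [indicator_of_mem, ENNReal.ofReal_prod_of_nonneg fun j _ => pow_nonneg (hp j) _]
      exact fun j => ((hfin j).cast_ncard_eq).symm
    · intro c hc
      refine indicator_of_notMem (fun hmem => hc ?_) _
      funext j
      have : {k | S k ω ∈ B j}.encard = (c j : ℕ∞) := hmem j
      rw [← (hfin j).cast_ncard_eq] at this
      exact_mod_cast this.symm
  have hleftm : Measurable fun ω => ∑' c : Fin n → ℕ, (A c).indicator
        (fun _ => ∏ j, ENNReal.ofReal (p j ^ c j)) ω :=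
    Measurable.tsum fun c => measurable_const.indicator (hm c).1
  have hright : ∀ ω, ∑' c : Fin n → ℕ, (∏ j, ENNReal.ofReal (p j ^ c j)) *
        ENNReal.ofReal (∏ j, (poissonMeasure (Λ ω (B j)).toNNReal).real {c j}) =
      ENNReal.ofReal (∏ j, Real.exp (-((1 - p j) * (Λ ω).real (B j)))) := by
    intro ω
    rw [ENNReal.ofReal_prod_of_nonneg fun j _ => (Real.exp_pos _).le]
    have := tsum_prod_fin n fun j c =>
      ENNReal.ofReal (p j ^ c * (poissonMeasure (Λ ω (B j)).toNNReal).real {c})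
    simp only [tsum_pow_mul_poissonMeasure _ (hp _)] at this
    refine Eq.trans (tsum_congr fun c => ?_) this
    rw [ENNReal.ofReal_prod_of_nonneg fun j _ => measureReal_nonneg, ← Finset.prod_mul_distrib]
    exact Finset.prod_congr rfl fun j _ => (ENNReal.ofReal_mul (pow_nonneg (hp j) _)).symm
  have hmeas : ∀ c : Fin n → ℕ, AEMeasurable (fun ω => (∏ j, ENNReal.ofReal (p j ^ c j)) *
      ENNReal.ofReal (∏ j, (poissonMeasure (Λ ω (B j)).toNNReal).real {c j})) P :=
    fun c => ((hm c).2.1.ennreal_ofReal).const_mul _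
  have hnn : ∀ ω, 0 ≤ ∏ᶠ k, ∏ j, (if S k ω ∈ B j then p j else 1) := fun ω =>
    finprod_nonneg fun k => Finset.prod_nonneg fun j _ => by split_ifs; exacts [hp j, zero_le_one]
  refine ⟨?_, ?_, ?_⟩
  · refine ((AEMeasurable.congr ⟨_, hleftm, ae_eq_rfl⟩ hleft.symm).ennreal_toReal).congr
      (ae_of_all _ fun ω => ENNReal.toReal_ofReal (hnn ω))
  · have := AEMeasurable.tsum (L := .unconditional _) hmeas
    simp only [hright] at this
    exact this.ennreal_toReal.congr
      (ae_of_all _ fun ω => ENNReal.toReal_ofReal (by positivity))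
  · simp_rw [← hright]
    rw [lintegral_congr_ae hleft, lintegral_tsum hmeas,
      lintegral_tsum fun c => (measurable_const.indicator (hm c).1).aemeasurable]
    refine tsum_congr fun c => ?_
    rw [lintegral_indicator_const (hm c).1, lintegral_const_mul'' _ (hm c).2.1.ennreal_ofReal,
      (hm c).2.2]

end Count

/-! ### The Laplace functional of a Cox process. -/

section Laplace

variable {Ω : Type*} {𝓖 : MeasurableSpace Ω} [mΩ : MeasurableSpace Ω] {P : Measure Ω}
  [IsProbabilityMeasure P] {Λ : Ω → Measure ℝ} {S : ℕ → Ω → ℝ}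

lemma finprod_mem_Icc {u : ℕ → ℝ} (hu : ∀ k, u k ∈ Icc (0 : ℝ) 1) : ∏ᶠ k, u k ∈ Icc (0 : ℝ) 1 :=
  finprod_induction (p := fun y => y ∈ Icc (0 : ℝ) 1) ⟨zero_le_one, le_rfl⟩
    (fun _ _ hx hy => ⟨mul_nonneg hx.1 hy.1, mul_le_one₀ hx.2 hy.1 hy.2⟩) hu

lemma tendsto_floor_mul_div {y : ℝ} (hy : 0 ≤ y) :
    Tendsto (fun m : ℕ => (⌊((m : ℝ) + 1) * y⌋₊ : ℝ) / (m + 1)) atTop (𝓝 y) := by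
  have := (tendsto_nat_floor_mul_div_atTop hy).comp
    (tendsto_atTop_add_const_right atTop (1 : ℝ) tendsto_natCast_atTop_atTop)
  simpa only [Function.comp_def, mul_comm] using this

lemma floor_mul_div_mem {y : ℝ} (hy : y ∈ Icc (0 : ℝ) 1) (m : ℕ) :
    (⌊((m : ℝ) + 1) * y⌋₊ : ℝ) / (m + 1) ∈ Icc (0 : ℝ) 1 := by
  have hm : (0 : ℝ) < m + 1 := by positivity
  refine ⟨by positivity, (div_le_one hm).2 ((Nat.floor_le (mul_nonneg hm.le hy.1)).trans ?_)⟩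
  nlinarith [hy.2]

lemma floor_mul_lt {y : ℝ} (hy : y ∈ Icc (0 : ℝ) 1) (m : ℕ) :
    ⌊((m : ℝ) + 1) * y⌋₊ < m + 2 := by
  have h := (div_le_one (by positivity : (0 : ℝ) < m + 1)).1 (floor_mul_div_mem hy m).2
  have : ⌊((m : ℝ) + 1) * y⌋₊ ≤ m + 1 := by exact_mod_cast h
  omega

open Classical in
lemma IsCoxProcess.integral_finprod_floor (h : IsCoxProcess 𝓖 P Λ S) (h𝓖 : 𝓖 ≤ mΩ) {f : ℝ → ℝ}
    (hf : Measurable f) (hf01 : ∀ x, f x ∈ Icc (0 : ℝ) 1) {D : Set ℝ} (hD : MeasurableSet D)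
    (hDb : Bornology.IsBounded D) (hfD : ∀ x, x ∉ D → f x = 0) (m : ℕ) :
    AEStronglyMeasurable
      (fun ω => ∏ᶠ k, (1 - (⌊((m : ℝ) + 1) * f (S k ω)⌋₊ : ℝ) / (m + 1))) P ∧
    AEStronglyMeasurable
      (fun ω => Real.exp (-∫ x, (⌊((m : ℝ) + 1) * f x⌋₊ : ℝ) / (m + 1) ∂Λ ω)) P ∧
    ∫ ω, ∏ᶠ k, (1 - (⌊((m : ℝ) + 1) * f (S k ω)⌋₊ : ℝ) / (m + 1)) ∂P =
      ∫ ω, Real.exp (-∫ x, (⌊((m : ℝ) + 1) * f x⌋₊ : ℝ) / (m + 1) ∂Λ ω) ∂P := by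
  -- Level sets of `f` rounded down to multiples of `1 / (m + 1)`; since `f` may equal `1` there are
  -- `m + 2` levels. Intersecting with `D` keeps the zero level bounded, and its factor is `1`.
  obtain ⟨B, hBdef⟩ : ∃ B : Fin (m + 2) → Set ℝ,
      ∀ j, B j = D ∩ {x | ⌊((m : ℝ) + 1) * f x⌋₊ = (j : ℕ)} := ⟨_, fun _ => rfl⟩
  have hmem : ∀ {j x}, x ∈ B j ↔ x ∈ D ∧ ⌊((m : ℝ) + 1) * f x⌋₊ = (j : ℕ) := fun {j x} => by
    rw [hBdef]; exact Iff.rfl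
  set p : Fin (m + 2) → ℝ := fun j => 1 - (j : ℝ) / (m + 1) with hpdef
  have hm : (0 : ℝ) < m + 1 := by positivity
  have hB : ∀ j, MeasurableSet (B j) := fun j => by
    rw [hBdef]
    exact hD.inter ((Nat.measurable_floor.comp (hf.const_mul _)) (measurableSet_singleton (j : ℕ)))
  have hb : ∀ j, Bornology.IsBounded (B j) := fun j => hDb.subset fun x hx => (hmem.1 hx).1
  have hd : Pairwise fun i j => Disjoint (B i) (B j) := fun i j hij =>
    Set.disjoint_left.2 fun x hx hx' => hij (Fin.ext ((hmem.1 hx).2.symm.trans (hmem.1 hx').2))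
  have hp : ∀ j, 0 ≤ p j := fun j => by
    have : (j : ℝ) ≤ m + 1 := by exact_mod_cast Nat.lt_succ_iff.1 j.2
    simpa [hpdef] using (div_le_one hm).2 this
  have hstep : ∀ x, ∏ j, (if x ∈ B j then p j else 1) =
      1 - (⌊((m : ℝ) + 1) * f x⌋₊ : ℝ) / (m + 1) := by
    intro x
    by_cases hx : x ∈ D
    · rw [Finset.prod_eq_single ⟨⌊((m : ℝ) + 1) * f x⌋₊, floor_mul_lt (hf01 x) m⟩]
      · rw [if_pos (hmem.2 ⟨hx, rfl⟩)]
      · intro j _ hj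
        exact if_neg fun hxj => hj (Fin.ext (hmem.1 hxj).2.symm)
      · simp
    · rw [Finset.prod_eq_one fun j _ => if_neg fun hxj => hx (hmem.1 hxj).1, hfD x hx]
      simp
  have hsum : ∀ x, (⌊((m : ℝ) + 1) * f x⌋₊ : ℝ) / (m + 1) =
      ∑ j, (B j).indicator (fun _ => 1 - p j) x := by
    intro x
    by_cases hx : x ∈ D
    · rw [Finset.sum_eq_single ⟨⌊((m : ℝ) + 1) * f x⌋₊, floor_mul_lt (hf01 x) m⟩]
      · rw [indicator_of_mem (hmem.2 ⟨hx, rfl⟩)]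
        simp [hpdef]
      · intro j _ hj
        exact indicator_of_notMem (fun hxj => hj (Fin.ext (hmem.1 hxj).2.symm)) _
      · simp
    · rw [Finset.sum_eq_zero fun j _ => indicator_of_notMem (fun hxj => hx (hmem.1 hxj).1) _, hfD x hx]
      simp
  have hexp : (fun ω => ∏ j, Real.exp (-((1 - p j) * (Λ ω).real (B j)))) =ᵐ[P]
      fun ω => Real.exp (-∫ x, (⌊((m : ℝ) + 1) * f x⌋₊ : ℝ) / (m + 1) ∂Λ ω) := by
    filter_upwards [h.locallyFinite] with ω hω
    simp_rw [hsum]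
    rw [integral_finsetSum, ← Real.exp_sum, ← Finset.sum_neg_distrib]
    · refine congrArg _ (Finset.sum_congr rfl fun j _ => ?_)
      rw [integral_indicator_const _ (hB j), smul_eq_mul, mul_comm]
    · exact fun j _ => (integrable_indicator_iff (hB j)).2
        (integrableOn_const (hb j).measure_lt_top.ne)
  obtain ⟨h1, h2, h3⟩ := h.lintegral_finprod_step h𝓖 hB hb hd hp
  simp_rw [hstep] at h1 h3
  refine ⟨h1.aestronglyMeasurable, (h2.congr hexp).aestronglyMeasurable, ?_⟩
  rw [← integral_congr_ae hexp, integral_eq_lintegral_of_nonneg_ae _ h1.aestronglyMeasurable, h3,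
    ← integral_eq_lintegral_of_nonneg_ae _ h2.aestronglyMeasurable]
  · exact ae_of_all _ fun ω => by positivity
  · exact ae_of_all _ fun ω => finprod_nonneg fun k =>
      sub_nonneg.2 (floor_mul_div_mem (hf01 _) m).2

/-- The Laplace functional of a Cox process. -/
lemma IsCoxProcess.integral_finprod (h : IsCoxProcess 𝓖 P Λ S) (h𝓖 : 𝓖 ≤ mΩ) {f : ℝ → ℝ}
    (hf : Measurable f) (hf01 : ∀ x, f x ∈ Icc (0 : ℝ) 1) {D : Set ℝ} (hD : MeasurableSet D)
    (hDb : Bornology.IsBounded D) (hfD : ∀ x, x ∉ D → f x = 0) :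
    ∫ ω, ∏ᶠ k, (1 - f (S k ω)) ∂P = ∫ ω, Real.exp (-∫ x, f x ∂Λ ω) ∂P := by
  have hfl := h.integral_finprod_floor h𝓖 hf hf01 hD hDb hfD
  have hmem := fun (m : ℕ) (x : ℝ) => floor_mul_div_mem (hf01 x) m
  have hl : Tendsto (fun m : ℕ =>
      ∫ ω, ∏ᶠ k, (1 - (⌊((m : ℝ) + 1) * f (S k ω)⌋₊ : ℝ) / (m + 1)) ∂P) atTop
      (𝓝 (∫ ω, ∏ᶠ k, (1 - f (S k ω)) ∂P)) := by
    refine tendsto_integral_of_dominated_convergence (fun _ => 1) (fun m => (hfl m).1)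
      (integrable_const 1) (fun m => ae_of_all _ fun ω => ?_) ?_
    · have := finprod_mem_Icc (u := fun k => 1 - (⌊((m : ℝ) + 1) * f (S k ω)⌋₊ : ℝ) / (m + 1))
        fun k => ⟨sub_nonneg.2 (hmem m _).2, sub_le_self _ (hmem m _).1⟩
      rw [Real.norm_of_nonneg this.1]
      exact this.2
    · filter_upwards [h.ae_finite h𝓖] with ω hω
      have hK := hω D hDb
      -- Only the finitely many points in `D` count, so the limit in `m` passes through a fixed
      -- finite product.
      have hsub : ∀ g : ℝ → ℝ, (∀ x, x ∉ D → g x = 0) →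
          ∏ᶠ k, (1 - g (S k ω)) = ∏ k ∈ hK.toFinset, (1 - g (S k ω)) := fun g hg =>
        finprod_eq_prod_of_mulSupport_subset _ fun k hk => by
          simp only [Finite.coe_toFinset, mem_ofPred_eq]
          by_contra hcon
          exact hk (by simp [hg _ hcon])
      rw [hsub f hfD]
      simp_rw [fun m : ℕ => hsub (fun x => (⌊((m : ℝ) + 1) * f x⌋₊ : ℝ) / (m + 1))
        fun x hx => by simp [hfD x hx]]
      exact tendsto_finsetProd _ fun k _ => (tendsto_floor_mul_div (hf01 _).1).const_sub 1
  have hr : Tendsto (fun m : ℕ =>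
      ∫ ω, Real.exp (-∫ x, (⌊((m : ℝ) + 1) * f x⌋₊ : ℝ) / (m + 1) ∂Λ ω) ∂P) atTop
      (𝓝 (∫ ω, Real.exp (-∫ x, f x ∂Λ ω) ∂P)) := by
    refine tendsto_integral_of_dominated_convergence (fun _ => 1) (fun m => (hfl m).2.1)
      (integrable_const 1) (fun m => ae_of_all _ fun ω => ?_) ?_
    · rw [Real.norm_of_nonneg (Real.exp_pos _).le, Real.exp_le_one_iff, neg_nonpos]
      exact integral_nonneg fun x => (hmem m x).1
    · filter_upwards [h.locallyFinite] with ω hω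
      refine (Real.continuous_exp.tendsto _).comp (Tendsto.neg ?_)
      refine tendsto_integral_of_dominated_convergence (D.indicator fun _ => 1) (fun m => ?_) ?_
        (fun m => ae_of_all _ fun x => ?_)
        (ae_of_all _ fun x => tendsto_floor_mul_div (hf01 x).1)
      · have : Measurable fun x => (⌊((m : ℝ) + 1) * f x⌋₊ : ℝ) :=
          measurable_from_nat.comp (Nat.measurable_floor.comp (hf.const_mul _))
        exact (this.div_const _).aestronglyMeasurable
      · exact (integrable_indicator_iff hD).2 (integrableOn_const hDb.measure_lt_top.ne)
      · rw [Real.norm_of_nonneg (hmem m x).1]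
        by_cases hx : x ∈ D
        · rw [indicator_of_mem hx]
          exact (hmem m x).2
        · simp [hfD x hx, indicator_of_notMem hx]
  simp_rw [fun m => (hfl m).2.2] at hl
  exact tendsto_nhds_unique hl hr

end Laplace

/-! ### Survival as the mean of a product over the starting times. -/

lemma IsCoxProcess.ae_nonneg {Ω : Type*} {𝓖 : MeasurableSpace Ω} [mΩ : MeasurableSpace Ω]
    {P : Measure Ω} [IsProbabilityMeasure P] {Λ : Ω → Measure ℝ} {S : ℕ → Ω → ℝ}
    (h : IsCoxProcess 𝓖 P Λ S) (h𝓖 : 𝓖 ≤ mΩ) (hΛ : ∀ᵐ ω ∂P, Λ ω (Iio 0) = 0) :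
    ∀ᵐ ω ∂P, ∀ k, 0 ≤ S k ω := by
  have key : ∀ m : ℕ, ∀ᵐ ω ∂P, pointCount S (Ico (-(m : ℝ)) 0) ω = 0 := by
    intro m
    obtain ⟨hA, -, hP⟩ := h.measure_pointCount h𝓖 (n := 1) (B := fun _ => Ico (-(m : ℝ)) 0)
      (fun _ => measurableSet_Ico) (fun _ => Metric.isBounded_Ico _ _)
      (fun i j hij => absurd (Subsingleton.elim i j) hij) (fun _ => 0)
    have h1 : (fun ω => ENNReal.ofReal (∏ _j : Fin 1,
        (poissonMeasure (Λ ω (Ico (-(m : ℝ)) 0)).toNNReal).real {0})) =ᵐ[P] fun _ => 1 := by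
      filter_upwards [hΛ] with ω hω
      rw [measure_mono_null Ico_subset_Iio_self hω]
      simp [poissonMeasure_real_singleton]
    rw [lintegral_congr_ae h1, lintegral_one, measure_univ] at hP
    filter_upwards [(mem_ae_iff_prob_eq_one hA).2 hP] with ω hω
    simpa using (hω : ∀ j : Fin 1, _) 0
  filter_upwards [ae_all_iff.2 key] with ω hω k
  by_contra! hk
  obtain ⟨m, hm⟩ := exists_nat_ge (-S k ω)
  have : {k : ℕ | S k ω ∈ Ico (-(m : ℝ)) 0} = ∅ := encard_eq_zero.1 (hω m)
  have hmem : k ∈ {k : ℕ | S k ω ∈ Ico (-(m : ℝ)) 0} := ⟨by linarith, hk⟩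
  rw [this] at hmem
  exact hmem

lemma coe_lt_coe_add_iff {t s : ℝ} {y : EReal} :
    (t : EReal) < (s : EReal) + y ↔ ((t - s : ℝ) : EReal) < y := by
  rw [EReal.coe_sub, EReal.sub_lt_iff (by simp) (by simp), add_comm]

lemma intensityMeasure_Iio {Ω : Type*} {lam δ : ℝ} {T : ℕ → Ω → ℝ} (ω : Ω) : intensityMeasure lam δ T ω (Iio 0) = 0 := by
  refine withDensity_absolutelyContinuous _ _ ?_
  rw [Measure.restrict_apply measurableSet_Iio]
  have : (Iio (0 : ℝ)) ∩ Ici 0 = ∅ := by ext; simp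
  simp [this]

section Survival

variable {Ω : Type*} [mΩ : MeasurableSpace Ω] {P : Measure Ω} {lam μ δ α β L : ℝ}
  {T S : ℕ → Ω → ℝ} {X : ℕ → ℝ≥0 → Ω → ℝ}

lemma IsModel.comap_le (h : IsModel P lam μ δ α β T S X) :
    MeasurableSpace.comap (fun ω i => T i ω) inferInstance ≤ mΩ :=
  (measurable_pi_lambda _ fun i => h.shocks.measurable i).comap_le

lemma IsModel.aemeasurable_failureTime (h : IsModel P lam μ δ α β T S X) :
    AEMeasurable (failureTime L S X) P := by
  have hm : ∀ k, Measurable fun ω => denseHittingTime L fun u => X k u ω := fun k =>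
    (measurable_denseHittingTime L).comp (measurable_pi_lambda _ (h.growth k).measurable)
  refine ⟨fun ω => ⨅ k, ((S k ω : ℝ) : EReal) + denseHittingTime L fun u => X k u ω,
    Measurable.iInf fun k => (h.starts.measurable k).coe_real_ereal.add (hm k), ?_⟩
  filter_upwards [ae_all_iff.2 fun k => (h.growth k).ae_denseHittingTime_eq (L := L)] with ω hσ
  simp_rw [hσ, failureTime]

variable [IsProbabilityMeasure P]

lemma IsModel.ae_shocks_nonneg (h : IsModel P lam μ δ α β T S X) : ∀ᵐ ω ∂P, ∀ i, 0 ≤ T i ω := by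
  refine h.shocks.ae_nonneg bot_le (ae_of_all _ fun _ => ?_)
  rw [Measure.smul_apply, Measure.restrict_apply measurableSet_Iio]
  have : (Iio (0 : ℝ)) ∩ Ici 0 = ∅ := by ext; simp
  simp [this]

lemma IsModel.ae_starts_nonneg (h : IsModel P lam μ δ α β T S X) : ∀ᵐ ω ∂P, ∀ k, 0 ≤ S k ω :=
  h.starts.ae_nonneg h.comap_le (ae_of_all _ intensityMeasure_Iio)

lemma IsModel.hittingCDF_eq (h : IsModel P lam μ δ α β T S X) (hα : 0 < α) (hβ : 0 < β)
    (hL : 0 < L) (k : ℕ) : hittingCDF P L (X k) = hittingCDF P L (X 0) := by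
  funext t
  rw [(h.growth k).hittingCDF_eq hα hβ hL, (h.growth 0).hittingCDF_eq hα hβ hL]

lemma IsModel.measure_denseHittingTime_gt (h : IsModel P lam μ δ α β T S X) (hα : 0 < α)
    (hβ : 0 < β) (hL : 0 < L) (k : ℕ) (u : ℝ) :
    P ((fun ω => denseHittingTime L fun t => X k t ω) ⁻¹' Ioi (u : EReal)) =
      ENNReal.ofReal (1 - hittingCDF P L (X 0) u) := by
  have hm : Measurable fun ω => denseHittingTime L fun t => X k t ω :=
    (measurable_denseHittingTime L).comp (measurable_pi_lambda _ (h.growth k).measurable)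
  rw [← h.hittingCDF_eq hα hβ hL k, hittingCDF]
  have h1 : P.real {ω | hittingTime L (X k) ω ≤ (u : EReal)} =
      P.real ((fun ω => denseHittingTime L fun t => X k t ω) ⁻¹' Iic (u : EReal)) := by
    refine measureReal_congr ?_
    filter_upwards [(h.growth k).ae_denseHittingTime_eq (L := L)] with ω hω
    apply propext
    change hittingTime L (X k) ω ≤ _ ↔ (denseHittingTime L fun t => X k t ω) ≤ _
    rw [hω]
  rw [h1, ← probReal_compl_eq_one_sub (hm measurableSet_Iic), ofReal_measureReal, ← preimage_compl,
    compl_Iic]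

/-- By independence the joint law is a product measure; with the starting times frozen, the section
has a product probability because the paths are independent of one another. -/
lemma IsModel.measure_forall_lt (h : IsModel P lam μ δ α β T S X) (hα : 0 < α) (hβ : 0 < β)
    (hL : 0 < L) (t : ℝ) (K : ℕ) :
    P.real {ω | ∀ k < K, ((t - S k ω : ℝ) : EReal) < denseHittingTime L fun u => X k u ω} =
      ∫ ω, ∏ k ∈ Finset.range K, (1 - hittingCDF P L (X 0) (t - S k ω)) ∂P := by
  set σ : (ℕ → ℝ≥0 → ℝ) → ℕ → EReal := fun x k => denseHittingTime L (x k)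
  have hσ : Measurable σ := measurable_pi_lambda _ fun k =>
    (measurable_denseHittingTime L).comp (measurable_pi_apply k)
  have hX : Measurable fun ω k t => X k t ω :=
    measurable_pi_lambda _ fun k => measurable_pi_lambda _ (h.growth k).measurable
  have hS : Measurable fun ω k => S k ω := measurable_pi_lambda _ h.starts.measurable
  have hind : IndepFun (fun ω k => S k ω) (fun ω => σ fun k t => X k t ω) P :=
    h.indep.comp measurable_snd hσ
  have hσX : Measurable fun ω => σ fun k t => X k t ω := hσ.comp hX
  have hlaw := hind.map_prod_eq_prod_map_map hS.aemeasurable hσX.aemeasurable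
  set A : Set ((ℕ → ℝ) × (ℕ → EReal)) :=
    ⋂ k ∈ Finset.range K, {q | ((t - q.1 k : ℝ) : EReal) < q.2 k} with hAdef
  have hA : MeasurableSet A := Finset.measurableSet_biInter _ fun k _ =>
    measurableSet_lt (by fun_prop) (by fun_prop)
  have hset : {ω | ∀ k < K, ((t - S k ω : ℝ) : EReal) < denseHittingTime L fun u => X k u ω} =
      (fun ω => ((fun k => S k ω), σ fun k t => X k t ω)) ⁻¹' A := by
    ext ω
    simp [hAdef, σ]
  have hF : Measurable (hittingCDF P L (X 0)) := monotone_hittingCDF.measurable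
  have hsec : ∀ s : ℕ → ℝ, (P.map fun ω => σ fun k t => X k t ω) (Prod.mk s ⁻¹' A) =
      ∏ k ∈ Finset.range K, ENNReal.ofReal (1 - hittingCDF P L (X 0) (t - s k)) := by
    intro s
    rw [Measure.map_apply hσX (measurable_prodMk_left hA)]
    have hi : iIndepFun (fun k ω => denseHittingTime L fun u => X k u ω) P :=
      h.growth_indep.comp (fun _ => denseHittingTime L) fun _ => measurable_denseHittingTime L
    have := hi.measure_inter_preimage_eq_mul (Finset.range K)
      (sets := fun k => Ioi ((t - s k : ℝ) : EReal)) fun _ _ => measurableSet_Ioi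
    simp_rw [h.measure_denseHittingTime_gt hα hβ hL] at this
    rw [← this]
    congr 1
    ext ω
    simp [hAdef, σ]
  rw [measureReal_def, hset, ← Measure.map_apply (hS.prodMk hσX) hA, hlaw,
    Measure.prod_apply hA, integral_eq_lintegral_of_nonneg_ae]
  · simp_rw [hsec]
    rw [lintegral_map (by fun_prop) hS]
    simp_rw [ENNReal.ofReal_prod_of_nonneg fun k _ => sub_nonneg.2 (hittingCDF_le_one _)]
  · exact ae_of_all _ fun ω => Finset.prod_nonneg fun k _ => sub_nonneg.2 (hittingCDF_le_one _)
  · have : ∀ k, Measurable (S k) := h.starts.measurable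
    exact (by fun_prop : Measurable fun ω =>
      ∏ k ∈ Finset.range K, (1 - hittingCDF P L (X 0) (t - S k ω))).aestronglyMeasurable

/-- A strict inequality need not survive an infinite infimum. Here only finitely many starts are at
most `t + 1`, and every other term is at least `t + 1`. -/
lemma IsModel.ae_lt_failureTime_iff (h : IsModel P lam μ δ α β T S X) (t : ℝ) :
    ∀ᵐ ω ∂P, (t : EReal) < failureTime L S X ω ↔
      ∀ k, ((t - S k ω : ℝ) : EReal) < denseHittingTime L fun u => X k u ω := by
  filter_upwards [h.starts.ae_finite h.comap_le, h.ae_starts_nonneg,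
    ae_all_iff.2 fun k => (h.growth k).ae_denseHittingTime_eq (L := L)] with ω hfin hnn hσ
  simp_rw [hσ, ← coe_lt_coe_add_iff, failureTime]
  refine ⟨fun hlt k => hlt.trans_le (iInf_le _ k), fun hlt => ?_⟩
  have hK := hfin (Icc 0 (t + 1)) (Metric.isBounded_Icc _ _)
  have h1 : (t : EReal) < hK.toFinset.inf fun k => (S k ω : EReal) + hittingTime L (X k) ω :=
    (Finset.lt_inf_iff (EReal.coe_lt_top t)).2 fun k _ => hlt k
  have h2 : (t : EReal) < ((t + 1 : ℝ) : EReal) := by exact_mod_cast lt_add_one t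
  refine (lt_min h1 h2).trans_le (le_iInf fun k => ?_)
  by_cases hk : S k ω ≤ t + 1
  · exact (min_le_left _ _).trans (Finset.inf_le (hK.mem_toFinset.2 ⟨hnn k, hk⟩))
  · refine (min_le_right _ _).trans ?_
    have h3 : ((t + 1 : ℝ) : EReal) ≤ (S k ω : EReal) := by exact_mod_cast (not_le.1 hk).le
    simpa using add_le_add h3 (hittingTime_nonneg L (X k) ω)

lemma IsModel.survival_eq_integral_finprod (h : IsModel P lam μ δ α β T S X) (hα : 0 < α)
    (hβ : 0 < β) (hL : 0 < L) (t : ℝ) :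
    survival P (failureTime L S X) t =
      ∫ ω, ∏ᶠ k, (1 - hittingCDF P L (X 0) (t - S k ω)) ∂P := by
  have hm : ∀ k, Measurable fun ω => denseHittingTime L fun u => X k u ω := fun k =>
    (measurable_denseHittingTime L).comp (measurable_pi_lambda _ (h.growth k).measurable)
  have hSm : ∀ k, Measurable (S k) := h.starts.measurable
  have hF : Measurable (hittingCDF P L (X 0)) := monotone_hittingCDF.measurable
  set E : ℕ → Set Ω := fun K =>
    {ω | ∀ k < K, ((t - S k ω : ℝ) : EReal) < denseHittingTime L fun u => X k u ω} with hE
  have hEm : ∀ K, MeasurableSet (E K) := fun K => by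
    have : E K = ⋂ k ∈ Finset.range K,
        {ω | ((t - S k ω : ℝ) : EReal) < denseHittingTime L fun u => X k u ω} := by
      ext ω; simp [hE]
    rw [this]
    exact Finset.measurableSet_biInter _ fun k _ =>
      measurableSet_lt (measurable_const.sub (hSm k)).coe_real_ereal (hm k)
  have h1 : survival P (failureTime L S X) t = P.real (⋂ K, E K) := by
    refine measureReal_congr ?_
    filter_upwards [h.ae_lt_failureTime_iff (L := L) t] with ω hω
    apply propext
    refine hω.trans ?_
    change _ ↔ ω ∈ ⋂ K, E K
    rw [mem_iInter]
    exact ⟨fun hk K k _ => hk k, fun hk k => hk (k + 1) k k.lt_succ_self⟩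
  have h2 : Tendsto (fun K => P.real (E K)) atTop (𝓝 (P.real (⋂ K, E K))) :=
    (ENNReal.tendsto_toReal (measure_ne_top _ _)).comp
      (tendsto_measure_iInter_atTop (fun K => (hEm K).nullMeasurableSet)
        (fun K K' hKK ω hω k hk => hω k (hk.trans_le hKK)) ⟨0, measure_ne_top _ _⟩)
  have h3 : Tendsto (fun K => ∫ ω, ∏ k ∈ Finset.range K,
      (1 - hittingCDF P L (X 0) (t - S k ω)) ∂P) atTop
      (𝓝 (∫ ω, ∏ᶠ k, (1 - hittingCDF P L (X 0) (t - S k ω)) ∂P)) := by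
    refine tendsto_integral_of_dominated_convergence (fun _ => 1)
      (fun K => (by fun_prop : Measurable fun ω =>
      ∏ k ∈ Finset.range K, (1 - hittingCDF P L (X 0) (t - S k ω))).aestronglyMeasurable)
      (integrable_const 1) (fun K => ae_of_all _ fun ω => ?_) ?_
    · rw [Real.norm_of_nonneg (Finset.prod_nonneg fun k _ => sub_nonneg.2 (hittingCDF_le_one _))]
      exact Finset.prod_le_one (fun k _ => sub_nonneg.2 (hittingCDF_le_one _))
        fun k _ => sub_le_self _ (hittingCDF_nonneg _)
    · filter_upwards [h.starts.ae_finite h.comap_le, h.ae_starts_nonneg] with ω hfin hnn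
      have hK := hfin (Icc 0 t) (Metric.isBounded_Icc _ _)
      obtain ⟨K₀, hK₀⟩ := hK.bddAbove
      -- Factors with `S k > t` equal `1`, so the partial products are constant once `K > K₀`.
      refine tendsto_const_nhds.congr' ?_
      filter_upwards [eventually_gt_atTop K₀] with K hKK
      refine finprod_eq_prod_of_mulSupport_subset _ fun k hk => ?_
      have hkt : S k ω ≤ t := by
        by_contra! hcon
        exact hk (by simp [hittingCDF_of_neg (P := P) (L := L) (X := X 0) (sub_neg.2 hcon)])
      have : k ≤ K₀ := hK₀ ⟨hnn k, hkt⟩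
      simp only [Finset.coe_range, mem_Iio]
      omega
  rw [h1]
  refine tendsto_nhds_unique h2 ?_
  simpa only [hE, h.measure_forall_lt hα hβ hL] using h3

lemma IsModel.ae_failureTime_nonneg (h : IsModel P lam μ δ α β T S X) :
    ∀ᵐ ω ∂P, 0 ≤ failureTime L S X ω := by
  filter_upwards [h.ae_starts_nonneg] with ω hω
  refine le_iInf fun k => ?_
  exact add_nonneg (by exact_mod_cast hω k) (hittingTime_nonneg L (X k) ω)

end Survival

/-! ### The cumulative effect of a single shock. -/

/-- The convolution over `[0, x]` of `F` with the exponential decay of rate `δ`. -/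
noncomputable def expConv (δ : ℝ) (F : ℝ → ℝ) (x : ℝ) : ℝ :=
  ∫ w in (0 : ℝ)..x, Real.exp (-δ * w) * F (x - w)

section

variable {δ : ℝ} {F : ℝ → ℝ}

lemma continuous_expConv (hF : Continuous F) : Continuous (expConv δ F) :=
  intervalIntegral.continuous_parametric_intervalIntegral_of_continuous
    (f := fun x w => Real.exp (-δ * w) * F (x - w)) (by fun_prop) continuous_id

lemma expConv_nonneg (hF0 : ∀ x, 0 ≤ F x) {x : ℝ} (hx : 0 ≤ x) : 0 ≤ expConv δ F x :=
  intervalIntegral.integral_nonneg hx fun _ _ => mul_nonneg (Real.exp_pos _).le (hF0 _)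

lemma monotoneOn_expConv (hF : Continuous F) (hF0 : ∀ x, 0 ≤ F x) (hmono : Monotone F) :
    MonotoneOn (expConv δ F) (Ici 0) := by
  intro x (hx : 0 ≤ x) y (hy : 0 ≤ y) hxy
  have hi : ∀ z a b : ℝ, IntervalIntegrable (fun w => Real.exp (-δ * w) * F (z - w)) volume a b :=
    fun z a b => (by fun_prop : Continuous fun w =>
      Real.exp (-δ * w) * F (z - w)).intervalIntegrable a b
  -- Passing from `x` to `y` first raises the integrand, then lengthens the interval.
  calc expConv δ F x ≤ ∫ w in (0 : ℝ)..x, Real.exp (-δ * w) * F (y - w) := by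
        refine intervalIntegral.integral_mono_on hx (hi _ _ _) (hi _ _ _) fun w _ => ?_
        exact mul_le_mul_of_nonneg_left (hmono (by linarith)) (Real.exp_pos _).le
    _ ≤ expConv δ F y := by
        rw [expConv, ← intervalIntegral.integral_add_adjacent_intervals (hi y 0 x) (hi y x y)]
        exact le_add_of_nonneg_right (intervalIntegral.integral_nonneg hxy fun w _ =>
          mul_nonneg (Real.exp_pos _).le (hF0 _))

lemma tendsto_expConv (hδ : 0 < δ) (hF : Continuous F) (hF01 : ∀ x, F x ∈ Icc (0 : ℝ) 1)
    (hneg : ∀ x < 0, F x = 0) (hlim : Tendsto F atTop (𝓝 1)) :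
    Tendsto (expConv δ F) atTop (𝓝 (1 / δ)) := by
  have hval : ∫ w in Ioi (0 : ℝ), Real.exp (-δ * w) * 1 = 1 / δ := by
    simp_rw [mul_one]
    rw [integral_exp_mul_Ioi (by linarith)]
    simp [neg_div_neg_eq]
  have hint : IntegrableOn (fun w => Real.exp (-δ * w)) (Ioi 0) := exp_neg_integrableOn_Ioi 0 hδ
  have h : Tendsto (fun x => ∫ w in Ioi (0 : ℝ), Real.exp (-δ * w) * F (x - w)) atTop
      (𝓝 (1 / δ)) := by
    rw [← hval]
    refine tendsto_integral_filter_of_dominated_convergence (fun w => Real.exp (-δ * w))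
      (.of_forall fun x => (by fun_prop : Continuous fun w =>
        Real.exp (-δ * w) * F (x - w)).aestronglyMeasurable)
      (.of_forall fun x => ae_of_all _ fun w => ?_) hint (ae_of_all _ fun w => ?_)
    · rw [Real.norm_of_nonneg (mul_nonneg (Real.exp_pos _).le (hF01 _).1)]
      exact mul_le_of_le_one_right (Real.exp_pos _).le (hF01 _).2
    · exact (hlim.comp (tendsto_atTop_add_const_right _ (-w) tendsto_id)).const_mul _
  -- `F` vanishes on the negatives, so the integral over the half-line stops at `x`.
  refine h.congr' ?_
  filter_upwards [eventually_ge_atTop 0] with x hx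
  rw [expConv, intervalIntegral.integral_of_le hx]
  refine setIntegral_eq_of_subset_of_forall_sdiff_eq_zero measurableSet_Ioi Ioc_subset_Ioi_self
    fun w hw => ?_
  have : x < w := by
    by_contra! hcon
    exact hw.2 ⟨hw.1, hcon⟩
  rw [hneg _ (by linarith), mul_zero]

end

/-! ### Integration against the shot noise intensity. -/

section

variable {Ω : Type*} {lam δ t : ℝ} {F : ℝ → ℝ} {T : ℕ → Ω → ℝ} {ω : Ω}

lemma setIntegral_shot {x : ℝ} (hx : x ∈ Icc 0 t) :
    ∫ s in Icc 0 t, (if x ≤ s then Real.exp (-δ * (s - x)) else 0) * F (t - s) =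
      expConv δ F (t - x) := by
  have h1 : ∀ s, (if x ≤ s then Real.exp (-δ * (s - x)) else 0) * F (t - s) =
      (Ici x).indicator (fun s => Real.exp (-δ * (s - x)) * F (t - s)) s := by
    intro s
    by_cases hs : x ≤ s
    · rw [if_pos hs, indicator_of_mem (mem_Ici.2 hs)]
    · rw [if_neg hs, indicator_of_notMem (by simpa using hs), zero_mul]
  have h2 : Icc 0 t ∩ Ici x = Icc x t := by
    ext s
    simp only [mem_inter_iff, mem_Icc, mem_Ici]
    constructor
    · rintro ⟨⟨-, h⟩, h'⟩; exact ⟨h', h⟩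
    · rintro ⟨h, h'⟩; exact ⟨⟨hx.1.trans h, h'⟩, h⟩
  simp_rw [h1]
  rw [setIntegral_indicator measurableSet_Ici, h2, integral_Icc_eq_integral_Ioc,
    ← intervalIntegral.integral_of_le hx.2, expConv]
  have := intervalIntegral.integral_comp_sub_right (a := x) (b := t)
    (fun w => Real.exp (-δ * w) * F (t - x - w)) x
  rw [sub_self] at this
  rw [← this]
  refine intervalIntegral.integral_congr fun s _ => ?_
  congr 2
  ring

/-- The integral of a function of the time left until `t` against the directing measure. -/
lemma integral_intensityMeasure (hlam : 0 ≤ lam) (ht : 0 ≤ t) (hF : Continuous F)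
    (hT : ∀ i, 0 ≤ T i ω) (hfin : {i | T i ω ∈ Icc 0 t}.Finite) :
    ∫ x, (Icc 0 t).indicator (fun s => F (t - s)) x ∂intensityMeasure lam δ T ω =
      lam * (∫ u in (0 : ℝ)..t, F u) + ∑ i ∈ hfin.toFinset, expConv δ F (t - T i ω) := by
  set D : ℝ → ℝ := fun s => lam +
    ∑ i ∈ hfin.toFinset, if T i ω ≤ s then Real.exp (-δ * (s - T i ω)) else 0 with hD
  have hterm : ∀ i s, 0 ≤ if T i ω ≤ s then Real.exp (-δ * (s - T i ω)) else 0 := fun i s => by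
    split_ifs <;> positivity
  have hD0 : ∀ s, 0 ≤ D s := fun s => add_nonneg hlam (Finset.sum_nonneg fun i _ => hterm i s)
  have hterm_m : ∀ i, Measurable fun s =>
      if T i ω ≤ s then Real.exp (-δ * (s - T i ω)) else 0 := fun i =>
    Measurable.ite measurableSet_Ici (by fun_prop) measurable_const
  have hDm : Measurable D := by
    refine measurable_const.add (Finset.measurable_fun_sum _ fun i _ => hterm_m i)
  -- Shocks after `t` do not affect the intensity on `[0, t]`, so the series reduces to a finite
  -- sum.
  have hint : ∀ s ∈ Icc 0 t, intensity lam δ T ω s = ENNReal.ofReal (D s) := by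
    intro s hs
    rw [intensity, hD, ENNReal.ofReal_add hlam (Finset.sum_nonneg fun i _ => hterm i s),
      ENNReal.ofReal_sum_of_nonneg fun i _ => hterm i s, tsum_eq_sum (s := hfin.toFinset)]
    · refine congrArg _ (Finset.sum_congr rfl fun i _ => ?_)
      split_ifs <;> simp
    · intro i hi
      rw [if_neg]
      intro hle
      exact hi (hfin.mem_toFinset.2 ⟨hT i, hle.trans hs.2⟩)
  have hrestr : (intensityMeasure lam δ T ω).restrict (Icc 0 t) =
      (volume.restrict (Icc 0 t)).withDensity fun s => ENNReal.ofReal (D s) := by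
    rw [intensityMeasure, restrict_withDensity measurableSet_Icc,
      Measure.restrict_restrict measurableSet_Icc, inter_eq_left.2 Icc_subset_Ici_self]
    exact withDensity_congr_ae ((ae_restrict_iff' measurableSet_Icc).2 (ae_of_all _ hint))
  have hFi : IntegrableOn (fun s => F (t - s)) (Icc 0 t) :=
    (by fun_prop : Continuous fun s => F (t - s)).continuousOn.integrableOn_Icc
  have hti : ∀ i ∈ hfin.toFinset, IntegrableOn (fun s =>
      (if T i ω ≤ s then Real.exp (-δ * (s - T i ω)) else 0) * F (t - s)) (Icc 0 t) := by
    intro i _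
    have hc : IntegrableOn (fun s => Real.exp (-δ * (s - T i ω)) * F (t - s)) (Icc 0 t) :=
      (by fun_prop : Continuous fun s =>
        Real.exp (-δ * (s - T i ω)) * F (t - s)).continuousOn.integrableOn_Icc
    refine (Integrable.indicator hc (measurableSet_Ici (a := T i ω))).congr (ae_of_all _ fun s => ?_)
    beta_reduce
    by_cases hs : T i ω ≤ s
    · rw [indicator_of_mem (mem_Ici.2 hs), if_pos hs]
    · rw [indicator_of_notMem (by simpa using hs), if_neg hs, zero_mul]
  rw [integral_indicator measurableSet_Icc, hrestr,
    integral_withDensity_eq_integral_toReal_smul hDm.ennreal_ofReal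
      (ae_of_all _ fun s => ENNReal.ofReal_lt_top)]
  simp_rw [ENNReal.toReal_ofReal (hD0 _), smul_eq_mul, hD, add_mul, Finset.sum_mul]
  rw [integral_add (hFi.const_mul lam) (integrable_finsetSum _ hti), integral_const_mul,
    integral_finsetSum _ hti, integral_Icc_eq_integral_Ioc, ← intervalIntegral.integral_of_le ht,
    intervalIntegral.integral_comp_sub_left, sub_self, sub_zero]
  exact congrArg _ (Finset.sum_congr rfl fun i hi => setIntegral_shot (hfin.mem_toFinset.1 hi))

end

/-! ### Closed form of the survival function. -/

section Model

variable {Ω : Type*} [mΩ : MeasurableSpace Ω] {P : Measure Ω} [IsProbabilityMeasure P]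
  {lam μ δ : ℝ} {T S : ℕ → Ω → ℝ} {F : ℝ → ℝ} {t : ℝ}

/-- The test function makes `1 - f (T i)` equal to `exp (-G (t - T i))` with `G = expConv δ F`, the
factor that a shock in `[0, t]` contributes to survival. -/
lemma integral_finprod_shocks (hμ : 0 ≤ μ)
    (hT : IsPoissonProcess P (ENNReal.ofReal μ • volume.restrict (Ici 0)) T) (hF : Continuous F)
    (hF0 : ∀ x, 0 ≤ F x) (ht : 0 ≤ t) :
    ∫ ω, ∏ᶠ i, (1 - (Icc 0 t).indicator (fun x => 1 - Real.exp (-expConv δ F (t - x))) (T i ω)) ∂P =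
      Real.exp (-(μ * ∫ u in (0 : ℝ)..t, (1 - Real.exp (-expConv δ F u)))) := by
  have hG := continuous_expConv (δ := δ) hF
  have hc : Continuous fun x => 1 - Real.exp (-expConv δ F (t - x)) := by fun_prop
  rw [IsCoxProcess.integral_finprod (𝓖 := ⊥) hT bot_le (hc.measurable.indicator measurableSet_Icc) ?_
    measurableSet_Icc (Metric.isBounded_Icc 0 t) fun x hx => indicator_of_notMem hx _]
  · rw [integral_const, probReal_univ, one_smul, integral_smul_measure,
      integral_indicator measurableSet_Icc, Measure.restrict_restrict measurableSet_Icc,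
      inter_eq_left.2 Icc_subset_Ici_self, integral_Icc_eq_integral_Ioc,
      ← intervalIntegral.integral_of_le ht,
      intervalIntegral.integral_comp_sub_left (fun u => 1 - Real.exp (-expConv δ F u)), sub_self,
      sub_zero, ENNReal.toReal_ofReal hμ, smul_eq_mul]
  · intro x
    by_cases hx : x ∈ Icc 0 t
    · rw [indicator_of_mem hx]
      have : 0 ≤ expConv δ F (t - x) := expConv_nonneg hF0 (sub_nonneg.2 hx.2)
      exact ⟨sub_nonneg.2 (Real.exp_le_one_iff.2 (neg_nonpos.2 this)),
        sub_le_self _ (Real.exp_pos _).le⟩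
    · rw [indicator_of_notMem hx]
      exact ⟨le_rfl, zero_le_one⟩

lemma IsModel.survival_eq {α β L : ℝ} {X : ℕ → ℝ≥0 → Ω → ℝ} (h : IsModel P lam μ δ α β T S X)
    (hlam : 0 ≤ lam) (hμ : 0 ≤ μ) (hα : 0 < α) (hβ : 0 < β) (hL : 0 < L) (ht : 0 ≤ t) :
    survival P (failureTime L S X) t =
      Real.exp (-(lam * ∫ u in (0 : ℝ)..t, hittingCDF P L (X 0) u)) *
      Real.exp (-(μ * ∫ u in (0 : ℝ)..t, (1 - Real.exp (-expConv δ (hittingCDF P L (X 0)) u)))) := by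
  set F := hittingCDF P L (X 0) with hFdef
  have hF : Continuous F := (h.growth 0).continuous_hittingCDF hα hβ hL
  have hF0 : ∀ x, 0 ≤ F x := hittingCDF_nonneg
  have hneg : ∀ x < 0, F x = 0 := fun x hx => hittingCDF_of_neg hx
  have h1 : survival P (failureTime L S X) t =
      ∫ ω, ∏ᶠ k, (1 - (Icc 0 t).indicator (fun s => F (t - s)) (S k ω)) ∂P := by
    rw [h.survival_eq_integral_finprod hα hβ hL]
    refine integral_congr_ae ?_
    filter_upwards [h.ae_starts_nonneg] with ω hω
    refine finprod_congr fun k => ?_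
    by_cases hk : S k ω ≤ t
    · rw [indicator_of_mem (mem_Icc.2 ⟨hω k, hk⟩)]
    · rw [indicator_of_notMem fun hmem => hk hmem.2, ← hFdef, hneg _ (by linarith)]
  rw [h1, h.starts.integral_finprod h.comap_le ((by fun_prop : Continuous fun s =>
      F (t - s)).measurable.indicator measurableSet_Icc) ?_ measurableSet_Icc
      (Metric.isBounded_Icc 0 t) fun x hx => indicator_of_notMem hx _,
    ← integral_finprod_shocks hμ h.shocks hF hF0 ht, ← integral_const_mul]
  · refine integral_congr_ae ?_
    filter_upwards [h.ae_shocks_nonneg, IsCoxProcess.ae_finite (𝓖 := ⊥) h.shocks bot_le]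
      with ω hω hfin
    have hK := hfin (Icc 0 t) (Metric.isBounded_Icc 0 t)
    rw [integral_intensityMeasure hlam ht hF hω hK, neg_add, Real.exp_add,
      ← Finset.sum_neg_distrib, Real.exp_sum]
    congr 1
    rw [finprod_eq_prod_of_mulSupport_subset (s := hK.toFinset)]
    · refine Finset.prod_congr rfl fun i hi => ?_
      have hi' : T i ω ∈ Icc 0 t := hK.mem_toFinset.1 hi
      rw [indicator_of_mem hi', sub_sub_cancel]
    · intro i hi
      simp only [Finite.coe_toFinset, mem_ofPred_eq]
      by_contra hcon
      exact hi (by beta_reduce; rw [indicator_of_notMem hcon, sub_zero])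
  · intro x
    by_cases hx : x ∈ Icc 0 t
    · rw [indicator_of_mem hx]
      exact ⟨hF0 _, hittingCDF_le_one _⟩
    · rw [indicator_of_notMem hx]
      exact ⟨le_rfl, zero_le_one⟩

end Model

/-! ### The failure rate: monotonicity, limit, and finiteness of the failure time. -/

/-- The failure rate of the shot noise model whose hitting times have the distribution function
`F`. -/
noncomputable def hazard (lam μ δ : ℝ) (F : ℝ → ℝ) (t : ℝ) : ℝ :=
  lam * F t + μ * (1 - Real.exp (-expConv δ F t))

section

variable {lam μ δ : ℝ} {F : ℝ → ℝ}

lemma continuous_hazard (hF : Continuous F) : Continuous (hazard lam μ δ F) := by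
  have := continuous_expConv (δ := δ) hF
  unfold hazard
  fun_prop

lemma monotoneOn_hazard (hlam : 0 ≤ lam) (hμ : 0 ≤ μ) (hF : Continuous F) (hF0 : ∀ x, 0 ≤ F x)
    (hmono : Monotone F) : MonotoneOn (hazard lam μ δ F) (Ici 0) := by
  intro x hx y hy hxy
  have h1 := hmono hxy
  have h2 := monotoneOn_expConv (δ := δ) hF hF0 hmono hx hy hxy
  unfold hazard
  gcongr

lemma tendsto_hazard (hδ : 0 < δ) (hF : Continuous F) (hF01 : ∀ x, F x ∈ Icc (0 : ℝ) 1)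
    (hneg : ∀ x < 0, F x = 0) (hlim : Tendsto F atTop (𝓝 1)) :
    Tendsto (hazard lam μ δ F) atTop (𝓝 (lam + μ * (1 - Real.exp (-1 / δ)))) := by
  have h1 := ((Real.continuous_exp.tendsto _).comp
    (tendsto_expConv hδ hF hF01 hneg hlim).neg).const_sub 1
  have h2 := (hlim.const_mul lam).add (h1.const_mul μ)
  rw [mul_one, ← neg_div] at h2
  exact h2

/-- Beyond some `a` the integrand exceeds `c / 2`, so the integral grows at least linearly. -/
lemma tendsto_integral_atTop {r : ℝ → ℝ} {c : ℝ} (hr : Continuous r) (hc : 0 < c)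
    (hlim : Tendsto r atTop (𝓝 c)) : Tendsto (fun t => ∫ u in (0 : ℝ)..t, r u) atTop atTop := by
  obtain ⟨a, ha⟩ := eventually_atTop.1 (hlim.eventually (lt_mem_nhds (half_lt_self hc)))
  have h1 : Tendsto (fun t => (∫ u in (0 : ℝ)..a, r u) + c / 2 * (t - a)) atTop atTop :=
    tendsto_atTop_add_const_left _ _
      ((tendsto_atTop_add_const_right _ (-a) tendsto_id).const_mul_atTop (half_pos hc))
  refine tendsto_atTop_mono' _ ?_ h1
  filter_upwards [eventually_ge_atTop a] with t ht
  rw [← intervalIntegral.integral_add_adjacent_intervals (hr.intervalIntegrable 0 a)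
    (hr.intervalIntegrable a t)]
  have h2 : ∫ _ in a..t, c / 2 ≤ ∫ u in a..t, r u :=
    intervalIntegral.integral_mono_on ht intervalIntegrable_const (hr.intervalIntegrable a t)
      fun u hu => (ha u hu.1).le
  rw [intervalIntegral.integral_const, smul_eq_mul] at h2
  linarith

end

section Model

variable {Ω : Type*} [mΩ : MeasurableSpace Ω] {P : Measure Ω} [IsProbabilityMeasure P]
  {lam μ δ α β L : ℝ} {T S : ℕ → Ω → ℝ} {X : ℕ → ℝ≥0 → Ω → ℝ}

lemma IsModel.survival_eq_exp_hazard (h : IsModel P lam μ δ α β T S X)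
    (hlam : 0 ≤ lam) (hμ : 0 ≤ μ) (hα : 0 < α) (hβ : 0 < β) (hL : 0 < L) {t : ℝ} (ht : 0 ≤ t) :
    survival P (failureTime L S X) t =
      Real.exp (-∫ u in (0 : ℝ)..t, hazard lam μ δ (hittingCDF P L (X 0)) u) := by
  have hF : Continuous (hittingCDF P L (X 0)) := (h.growth 0).continuous_hittingCDF hα hβ hL
  have hG := continuous_expConv (δ := δ) hF
  unfold hazard
  rw [h.survival_eq hlam hμ hα hβ hL ht, ← Real.exp_add,
    intervalIntegral.integral_add (Continuous.intervalIntegrable (by fun_prop) _ _)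
      (Continuous.intervalIntegrable (by fun_prop) _ _),
    intervalIntegral.integral_const_mul, intervalIntegral.integral_const_mul]
  ring_nf

lemma IsModel.hasDerivWithinAt_survival (h : IsModel P lam μ δ α β T S X)
    (hlam : 0 ≤ lam) (hμ : 0 ≤ μ) (hα : 0 < α) (hβ : 0 < β) (hL : 0 < L) {t : ℝ} (ht : 0 ≤ t) :
    HasDerivWithinAt (survival P (failureTime L S X))
      (-(hazard lam μ δ (hittingCDF P L (X 0)) t * survival P (failureTime L S X) t)) (Ici 0) t := by
  have hr : Continuous (hazard lam μ δ (hittingCDF P L (X 0))) :=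
    continuous_hazard ((h.growth 0).continuous_hittingCDF hα hβ hL)
  have h1 := ((hr.integral_hasStrictDerivAt 0 t).hasDerivAt.neg.exp).hasDerivWithinAt (s := Ici 0)
  rw [h.survival_eq_exp_hazard hlam hμ hα hβ hL ht]
  refine (h1.congr (fun x hx => h.survival_eq_exp_hazard hlam hμ hα hβ hL hx)
    (h.survival_eq_exp_hazard hlam hμ hα hβ hL ht)).congr_deriv ?_
  simp only [Pi.neg_apply]
  ring

lemma IsModel.failureRate_eq (h : IsModel P lam μ δ α β T S X)
    (hlam : 0 ≤ lam) (hμ : 0 ≤ μ) (hα : 0 < α) (hβ : 0 < β) (hL : 0 < L) {t : ℝ} (ht : 0 ≤ t) :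
    failureRate P (failureTime L S X) t = hazard lam μ δ (hittingCDF P L (X 0)) t := by
  have hpos : survival P (failureTime L S X) t ≠ 0 := by
    rw [h.survival_eq_exp_hazard hlam hμ hα hβ hL ht]
    exact (Real.exp_pos _).ne'
  rw [failureRate, (h.hasDerivWithinAt_survival hlam hμ hα hβ hL ht).derivWithin
    (uniqueDiffOn_Ici 0 t ht), neg_neg, mul_div_cancel_right₀ _ hpos]

lemma IsModel.tendsto_hazard (h : IsModel P lam μ δ α β T S X) (hδ : 0 < δ) (hα : 0 < α)
    (hβ : 0 < β) (hL : 0 < L) :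
    Tendsto (hazard lam μ δ (hittingCDF P L (X 0))) atTop
      (𝓝 (lam + μ * (1 - Real.exp (-1 / δ)))) :=
  ShotNoise.tendsto_hazard hδ ((h.growth 0).continuous_hittingCDF hα hβ hL)
    (fun x => ⟨hittingCDF_nonneg x, hittingCDF_le_one x⟩) (fun _ hx => hittingCDF_of_neg hx)
    ((h.growth 0).tendsto_hittingCDF hα hβ hL)

/-- The failure rate has a positive limit, so its integral diverges and survival tends to `0`; the
event of no failure lies in every survival event. -/
lemma IsModel.ae_failureTime_lt_top (h : IsModel P lam μ δ α β T S X)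
    (hlam : 0 < lam) (hμ : 0 ≤ μ) (hδ : 0 < δ) (hα : 0 < α) (hβ : 0 < β) (hL : 0 < L) :
    ∀ᵐ ω ∂P, failureTime L S X ω < ⊤ := by
  have hpos : 0 < lam + μ * (1 - Real.exp (-1 / δ)) := by
    have : Real.exp (-1 / δ) ≤ 1 :=
      Real.exp_le_one_iff.2 (div_nonpos_of_nonpos_of_nonneg (by norm_num) hδ.le)
    have := mul_nonneg hμ (sub_nonneg.2 this)
    linarith
  have hlim : Tendsto (survival P (failureTime L S X)) atTop (𝓝 0) := by
    refine (Real.tendsto_exp_neg_atTop_nhds_zero.comp (tendsto_integral_atTop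
      (continuous_hazard ((h.growth 0).continuous_hittingCDF hα hβ hL)) hpos
      (h.tendsto_hazard hδ hα hβ hL))).congr' ?_
    filter_upwards [eventually_ge_atTop 0] with t ht
    exact (h.survival_eq_exp_hazard hlam.le hμ hα hβ hL ht).symm
  have hle : P.real {ω | failureTime L S X ω = ⊤} ≤ 0 := by
    refine ge_of_tendsto' hlim fun t => measureReal_mono fun ω (hω : failureTime L S X ω = ⊤) => ?_
    change (t : EReal) < failureTime L S X ω
    rw [hω]
    exact EReal.coe_lt_top t
  have hzero : P {ω | failureTime L S X ω = ⊤} = 0 :=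
    (measureReal_eq_zero_iff).1 (le_antisymm hle measureReal_nonneg)
  filter_upwards [measure_eq_zero_iff_ae_notMem.1 hzero] with ω hω
  exact lt_top_iff_ne_top.2 hω

end Model

end ShotNoise

theorem mainTheorem2 {Ω : Type*} [MeasurableSpace Ω] (P : Measure Ω) [IsProbabilityMeasure P]
    (lam μ δ α β L : ℝ) (hlam : 0 < lam) (hμ : 0 < μ) (hδ : 0 < δ) (hα : 0 < α) (hβ : 0 < β)
    (hL : 0 < L) (T S : ℕ → Ω → ℝ) (X : ℕ → ℝ≥0 → Ω → ℝ)
    (hM : ShotNoise.IsModel P lam μ δ α β T S X) :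
    -- the distribution function of the hitting times
    (∀ k, ShotNoise.hittingCDF P L (X k) 0 = 0 ∧
      ∀ t, 0 < t → ShotNoise.hittingCDF P L (X k) t =
        (∫ z in Ioi (β * L), z ^ (α * t - 1) * Real.exp (-z)) / Real.Gamma (α * t)) ∧
    -- the failure time is IFR
    ShotNoise.IsIFR P (ShotNoise.failureTime L S X) ∧
    -- the failure rate on the whole half-line
    (∀ t, 0 ≤ t → 0 < ShotNoise.survival P (ShotNoise.failureTime L S X) t) ∧
    (∀ k t, 0 ≤ t → ShotNoise.failureRate P (ShotNoise.failureTime L S X) t =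
      lam * ShotNoise.hittingCDF P L (X k) t +
        μ * (1 - Real.exp (-∫ w in (0 : ℝ)..t,
          Real.exp (-δ * w) * ShotNoise.hittingCDF P L (X k) (t - w)))) ∧
    MonotoneOn (ShotNoise.failureRate P (ShotNoise.failureTime L S X)) (Ici 0) ∧
    Tendsto (ShotNoise.failureRate P (ShotNoise.failureTime L S X)) atTop
      (𝓝 (lam + μ * (1 - Real.exp (-1 / δ)))) := by
  have hrate : ∀ t : ℝ, 0 ≤ t → ShotNoise.failureRate P (ShotNoise.failureTime L S X) t =
      ShotNoise.hazard lam μ δ (ShotNoise.hittingCDF P L (X 0)) t := fun t ht =>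
    hM.failureRate_eq hlam.le hμ.le hα hβ hL ht
  have hmono : MonotoneOn (ShotNoise.failureRate P (ShotNoise.failureTime L S X)) (Ici 0) :=
    (ShotNoise.monotoneOn_hazard hlam.le hμ.le ((hM.growth 0).continuous_hittingCDF hα hβ hL)
      ShotNoise.hittingCDF_nonneg ShotNoise.monotone_hittingCDF).congr fun t ht => (hrate t ht).symm
  refine ⟨fun k => ⟨?_, fun t ht => (hM.growth k).hittingCDF_of_nonneg hα hβ hL ht.le⟩,
    ⟨hM.aemeasurable_failureTime, ?_, fun t ht _ =>
      (hM.hasDerivWithinAt_survival hlam.le hμ.le hα hβ hL ht).differentiableWithinAt,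
      hmono.mono fun t ht => ht.1⟩, fun t ht => ?_, fun k t ht => ?_, hmono, ?_⟩
  · rw [(hM.growth k).hittingCDF_of_nonneg hα hβ hL le_rfl, mul_zero, ShotNoise.gammaTail_zero]
  · filter_upwards [hM.ae_failureTime_nonneg, hM.ae_failureTime_lt_top hlam hμ.le hδ hα hβ hL]
      with ω h0 h1 using ⟨h0, h1⟩
  · rw [hM.survival_eq_exp_hazard hlam.le hμ.le hα hβ hL ht]
    exact Real.exp_pos _
  · rw [hrate t ht, hM.hittingCDF_eq hα hβ hL k]
    rfl
  · refine (hM.tendsto_hazard hδ hα hβ hL).congr' ?_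
    filter_upwards [eventually_ge_atTop 0] with t ht using (hrate t ht).symm
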